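/- **Setting.** A seller owns an indivisible good and faces one buyer. The seller's type is $x\in X=\{1,\dots,\bar x\}$ and the buyer's type is $y\in Y=\{1,\dots,\bar y\}$; the types are independent with full-support distributions $p_1\in\Delta(X)$ and $p_2\in\Delta(Y)$. The seller's and the buyer's valuations are $v_1(x,y)=v_1^1(x)+v_1^2(y)\ge 0$ and $v_2(x,y)=v_2^1(x)+v_2^2(y)\ge 0$, where $v_1^1,v_2^2$ are strictly increasing and $v_1^2,v_2^1$ are weakly increasing. At an outcome $(q,t)\in[0,1]\times\mathbb R$ (probability of trade, payment from the buyer to the seller) the seller's payoff is $t+v_1(x,y)(1-q)$ and the buyer's payoff is $v_2(x,y)q-t$. A *mechanism* $G=\langle S_1,S_2,q,t\rangle$ consists of nonempty finite action sets $S_1,S_2$ and functions $q:S_1\times S_2\to[0,1]$, $t:S_1\times S_2\to\mathbb R$; let $\mathcal G$ be the set of all mechanisms, endowed with an arbitrary sigma-algebra. In the *mechanism-selection game*, each player observes his or her own type, the seller offers some $G\in\mathcal G$, and the buyer accepts or rejects. Rejection yields $(0,0)$; after acceptance the players simultaneously choose $s_1\in S_1$, $s_2\in S_2$ and the outcome is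 $(q(s_1,s_2),t(s_1,s_2))$. **RSW payoffs.** An *allocation* is a pair $g=(q,t)$ with $q:X\times Y\to[0,1]$, $t:X\times Y\to\mathbb R$. Put $U_1^g(\hat x\mid x)=\sum_y p_2(y)\,[t(\hat x,y)+v_1(x,y)(1-q(\hat x,y))]$, $U_1^g(x)=U_1^g(x\mid x)$ and $u_2^g(\hat y\mid x,y)=v_2(x,y)q(x,\hat y)-t(x,\hat y)$. An allocation $g^*$ is an *RSW allocation* if, for every $x\in X$ simultaneously, it maximizes $U_1^g(x)$ among all allocations $g$ such that $U_1^g(x)\ge U_1^g(\hat x\mid x)$ for all $x,\hat x$, $u_2^g(y\mid x,y)\ge u_2^g(\hat y\mid x,y)$ for all $x,y,\hat y$, and $u_2^g(y\mid x,y)\ge 0$ for all $x,y$. **Continuations.** Given $G$ and a belief $\pi_1\in\Delta(X)$ of the buyer, a *sequential equilibrium of the continuation game* consists of acceptance probabilities $\gamma_2(y)\in[0,1]$, mixed actions $\sigma_1(\cdot\mid x)\in\Delta(S_1)$, $\sigma_2(\cdot\mid y)\in\Delta(S_2)$ and a belief $\pi_2\in\Delta(Y)$ of the seller after acceptance such that: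 (a) for every $x$, $\sigma_1(\cdot\mid x)$ is optimal against $\sigma_2$ under $\pi_2$; for every $y$, $\sigma_2(\cdot\mid y)$ is optimal against $\sigma_1$ under $\pi_1$; and for every $y$, $\gamma_2(y)$ is optimal given the resulting expected payoff from acceptance and the payoff $0$ from rejection; (b) there are $\gamma_2^k:Y\to(0,1)$ with $\gamma_2^k\to\gamma_2$ and $p_2(y)\gamma_2^k(y)/\sum_{y'}p_2(y')\gamma_2^k(y')\to\pi_2(y)$ for every $y$. The induced allocation is $\gamma_2(y)\sum_{s_1,s_2}\sigma_1(s_1\mid x)\sigma_2(s_2\mid y)\,(q(s_1,s_2),t(s_1,s_2))$. Let $BR(G)$ be the set of allocations so induced, over all $\pi_1\in\Delta(X)$. **Equilibrium.** An *equilibrium* consists of probability measures $\gamma_1(x)$ on $\mathcal G$ ($x\in X$), beliefs $\pi_1^G\in\Delta(X)$ and continuations $(\gamma_2^G,\sigma_1^G,\sigma_2^G,\pi_2^G)$ for all $G\in\mathcal G$, with induced allocations $g^G$, such that: for all $x,y$, both components of $G\mapsto g^G(x,y)$ are $\gamma_1(x)$-integrable; for every $G$ (on or off the path) the continuation is a sequential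 equilibrium given $\pi_1^G$; for every $x$ and $G'$, $U_1^{g^{G'}}(x)\le\int U_1^{g^G}(x)\,d\gamma_1(x)(G)$; and Bayes' rule holds on the path, i.e. with $\mu=\sum_x p_1(x)\gamma_1(x)$, for each $x$ the function $G\mapsto\pi_1^G(x)$ is $\mu$-a.e. measurable and is a density of $p_1(x)\gamma_1(x)$ with respect to $\mu$. Its *equilibrium allocation* is $\tilde g(x,y)=\int g^G(x,y)\,d\gamma_1(x)(G)$. **Criterion D1.** Let $D(x,G)$ and $D^0(x,G)$ be the sets of $g'\in BR(G)$ with $U_1^{g'}(x)>U_1^{\tilde g}(x)$ and $U_1^{g'}(x)=U_1^{\tilde g}(x)$ respectively. The equilibrium *passes D1* if, for every mechanism $G$ and every $x$, $\pi_1^G(x)=0$ whenever there is $x'\ne x$ with $D(x,G)\cup D^0(x,G)\subsetneq D(x',G)$. **Theorem 2.** Let $\tilde g$ be the equilibrium allocation of an equilibrium that passes D1. Then the seller's interim payoff vector in $\tilde g$ is the RSW payoff vector: an RSW allocation exists, and $U_1^{\tilde g}(x)=U_1^{g^*}(x)$ for every $x\in X$ and every RSW allocation $g^*$. -/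

import Mathlib

open MeasureTheory Filter Topology

namespace InformedSeller

/-- The primitives of the bilateral trading environment. The seller's types are `Fin nx`, the
buyer's types are `Fin ny`; `p₁`, `p₂` are the full-support priors, and trader `i`'s valuation at
the type profile `(x, y)` is `vi1 x + vi2 y ≥ 0`. -/
structure Environment (nx ny : ℕ) where
  p₁ : Fin nx → ℝ
  p₂ : Fin ny → ℝ
  p₁_mem : p₁ ∈ stdSimplex ℝ (Fin nx)
  p₂_mem : p₂ ∈ stdSimplex ℝ (Fin ny)
  p₁_pos : ∀ x, 0 < p₁ x
  p₂_pos : ∀ y, 0 < p₂ y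
  v11 : Fin nx → ℝ
  v12 : Fin ny → ℝ
  v21 : Fin nx → ℝ
  v22 : Fin ny → ℝ
  v11_strictMono : StrictMono v11
  v12_mono : Monotone v12
  v21_mono : Monotone v21
  v22_strictMono : StrictMono v22
  v1_nonneg : ∀ x y, 0 ≤ v11 x + v12 y
  v2_nonneg : ∀ x y, 0 ≤ v21 x + v22 y

/-- The seller's valuation. -/
def Environment.v₁ {nx ny : ℕ} (E : Environment nx ny) (x : Fin nx) (y : Fin ny) : ℝ :=
  E.v11 x + E.v12 y

/-- The buyer's valuation. -/
def Environment.v₂ {nx ny : ℕ} (E : Environment nx ny) (x : Fin nx) (y : Fin ny) : ℝ :=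
  E.v21 x + E.v22 y

/-- A mechanism: a finite strategic game form. A menu, where the seller is inactive, is
a mechanism in which `S₁` has a single element. -/
structure Mechanism where
  S₁ : Type
  S₂ : Type
  [fintype₁ : Fintype S₁]
  [fintype₂ : Fintype S₂]
  [nonempty₁ : Nonempty S₁]
  [nonempty₂ : Nonempty S₂]
  q : S₁ → S₂ → ℝ
  t : S₁ → S₂ → ℝ
  q_mem : ∀ s₁ s₂, q s₁ s₂ ∈ Set.Icc (0 : ℝ) 1

attribute [instance] Mechanism.fintype₁ Mechanism.fintype₂ Mechanism.nonempty₁ Mechanism.nonempty₂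

/-- A pair of an allocation rule and a payment rule on type profiles; the constraint
`q ∈ [0,1]` is the predicate `Allocation.Valid`. -/
@[ext]
structure Allocation (nx ny : ℕ) where
  q : Fin nx → Fin ny → ℝ
  t : Fin nx → Fin ny → ℝ

def Allocation.Valid {nx ny : ℕ} (g : Allocation nx ny) : Prop :=
  ∀ x y, g.q x y ∈ Set.Icc (0 : ℝ) 1

section Allocations

variable {nx ny : ℕ} (E : Environment nx ny)

/-- The seller's interim payoff from reporting `x'` when her type is `x`. -/
def sellerReport (g : Allocation nx ny) (x' x : Fin nx) : ℝ :=
  ∑ y, E.p₂ y * (g.t x' y + E.v₁ x y * (1 - g.q x' y))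

/-- The seller's interim payoff vector. -/
def U₁ (g : Allocation nx ny) (x : Fin nx) : ℝ :=
  sellerReport E g x x

/-- The buyer's ex post payoff from reporting `y'` at the type profile `(x, y)`. -/
def buyerReport (g : Allocation nx ny) (y' : Fin ny) (x : Fin nx) (y : Fin ny) : ℝ :=
  E.v₂ x y * g.q x y' - g.t x y'

def BICSeller (g : Allocation nx ny) : Prop :=
  ∀ x x', sellerReport E g x' x ≤ U₁ E g x

def EPICBuyer (g : Allocation nx ny) : Prop :=
  ∀ x y y', buyerReport E g y' x y ≤ buyerReport E g y x y

def EPIRBuyer (g : Allocation nx ny) : Prop :=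
  ∀ x y, 0 ≤ buyerReport E g y x y

/-- The constraints in the problem that defines RSW allocations. -/
def RSWConstraints (g : Allocation nx ny) : Prop :=
  g.Valid ∧ BICSeller E g ∧ EPICBuyer E g ∧ EPIRBuyer E g

/-- A Rothschild--Stiglitz--Wilson allocation: it solves the problem of maximizing `U₁ g x`
subject to the constraints, for every type `x` simultaneously. -/
def IsRSW (g : Allocation nx ny) : Prop :=
  RSWConstraints E g ∧ ∀ x, ∀ g', RSWConstraints E g' → U₁ E g' x ≤ U₁ E g x

end Allocations

/-- What is played, and what the seller believes, after the mechanism `G` is offered: the buyer's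
acceptance probabilities, both players' mixed actions in `G`, and the seller's belief about the
buyer's type after acceptance. -/
structure Continuation (nx ny : ℕ) (G : Mechanism) where
  γ₂ : Fin ny → ℝ
  σ₁ : Fin nx → G.S₁ → ℝ
  σ₂ : Fin ny → G.S₂ → ℝ
  π₂ : Fin ny → ℝ
  γ₂_mem : ∀ y, γ₂ y ∈ Set.Icc (0 : ℝ) 1
  σ₁_mem : ∀ x, σ₁ x ∈ stdSimplex ℝ G.S₁
  σ₂_mem : ∀ y, σ₂ y ∈ stdSimplex ℝ G.S₂
  π₂_mem : π₂ ∈ stdSimplex ℝ (Fin ny)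

namespace Continuation

variable {nx ny : ℕ} {G : Mechanism}

/-- The allocation induced by a continuation; rejection gives the no-trade outcome `(0, 0)`. -/
def allocation (c : Continuation nx ny G) : Allocation nx ny where
  q x y := c.γ₂ y * ∑ s₁, ∑ s₂, c.σ₁ x s₁ * c.σ₂ y s₂ * G.q s₁ s₂
  t x y := c.γ₂ y * ∑ s₁, ∑ s₂, c.σ₁ x s₁ * c.σ₂ y s₂ * G.t s₁ s₂

variable (E : Environment nx ny)

/-- Payoff of the seller of type `x` from the mixed action `τ` after `G` is accepted. -/
def sellerPayoff (c : Continuation nx ny G) (x : Fin nx) (τ : G.S₁ → ℝ) : ℝ :=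
  ∑ y, c.π₂ y * ∑ s₁, ∑ s₂, τ s₁ * c.σ₂ y s₂ * (G.t s₁ s₂ + E.v₁ x y * (1 - G.q s₁ s₂))

/-- Payoff of the buyer of type `y` with belief `π₁` from the mixed action `τ` after he
accepts `G`. -/
def buyerPayoff (c : Continuation nx ny G) (π₁ : Fin nx → ℝ) (y : Fin ny) (τ : G.S₂ → ℝ) : ℝ :=
  ∑ x, π₁ x * ∑ s₁, ∑ s₂, c.σ₁ x s₁ * τ s₂ * (E.v₂ x y * G.q s₁ s₂ - G.t s₁ s₂)

/-- Sequential rationality, at every information set that follows the offer of `G`. -/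
def SequentiallyRational (c : Continuation nx ny G) (π₁ : Fin nx → ℝ) : Prop :=
  (∀ x, ∀ τ ∈ stdSimplex ℝ G.S₁, c.sellerPayoff E x τ ≤ c.sellerPayoff E x (c.σ₁ x)) ∧
  (∀ y, ∀ τ ∈ stdSimplex ℝ G.S₂, c.buyerPayoff E π₁ y τ ≤ c.buyerPayoff E π₁ y (c.σ₂ y)) ∧
  (∀ y, ∀ a ∈ Set.Icc (0 : ℝ) 1,
    a * c.buyerPayoff E π₁ y (c.σ₂ y) ≤ c.γ₂ y * c.buyerPayoff E π₁ y (c.σ₂ y))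

/-- Consistency of the seller's belief after acceptance: it is the limit of the Bayesian
posteriors for completely mixed acceptance plans that converge to `γ₂`. (No other belief is
constrained here: the buyer learns nothing new about the seller between the offer and the
simultaneous moves, and every `σ₁`, `σ₂` is a limit of completely mixed ones.) -/
def Consistent (c : Continuation nx ny G) : Prop :=
  ∃ a : ℕ → Fin ny → ℝ, (∀ k y, a k y ∈ Set.Ioo (0 : ℝ) 1) ∧
    (∀ y, Tendsto (fun k => a k y) atTop (𝓝 (c.γ₂ y))) ∧
    (∀ y, Tendsto (fun k => E.p₂ y * a k y / ∑ y', E.p₂ y' * a k y') atTop (𝓝 (c.π₂ y)))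

/-- Sequential equilibrium of the continuation game given the belief `π₁` and `G`. -/
def IsSequentialEquilibrium (c : Continuation nx ny G) (π₁ : Fin nx → ℝ) : Prop :=
  c.SequentiallyRational E π₁ ∧ c.Consistent E

end Continuation

section Refinement

variable {nx ny : ℕ} (E : Environment nx ny)

/-- The sequential equilibrium allocations of the continuation game given `(π₁, G)`. -/
def BR (π₁ : Fin nx → ℝ) (G : Mechanism) : Set (Allocation nx ny) :=
  {g | ∃ c : Continuation nx ny G, c.IsSequentialEquilibrium E π₁ ∧ g = c.allocation}

/-- The union of `BR π₁ G` over all beliefs `π₁`. -/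
def BRAll (G : Mechanism) : Set (Allocation nx ny) :=
  {g | ∃ π₁ ∈ stdSimplex ℝ (Fin nx), g ∈ BR E π₁ G}

/-- Responses to `G` that make type `x` strictly better off than the allocation `g`. -/
def D (g : Allocation nx ny) (x : Fin nx) (G : Mechanism) : Set (Allocation nx ny) :=
  {g' | g' ∈ BRAll E G ∧ U₁ E g x < U₁ E g' x}

/-- Responses to `G` that make type `x` exactly as well off as the allocation `g`. -/
def D0 (g : Allocation nx ny) (x : Fin nx) (G : Mechanism) : Set (Allocation nx ny) :=
  {g' | g' ∈ BRAll E G ∧ U₁ E g' x = U₁ E g x}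

end Refinement

/-- An assessment of the mechanism-selection game: the seller's mechanism-selection plan, the
buyer's belief about the seller's type after each offer, and the continuation after each offer. -/
structure Assessment (nx ny : ℕ) [MeasurableSpace Mechanism] where
  γ₁ : Fin nx → Measure Mechanism
  γ₁_prob : ∀ x, IsProbabilityMeasure (γ₁ x)
  π₁ : Mechanism → Fin nx → ℝ
  π₁_mem : ∀ G, π₁ G ∈ stdSimplex ℝ (Fin nx)
  cont : (G : Mechanism) → Continuation nx ny G

namespace Assessment

variable {nx ny : ℕ} [MeasurableSpace Mechanism]

/-- The integrals that define the induced allocation are meaningful. -/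
def OutcomeIntegrable (A : Assessment nx ny) : Prop :=
  ∀ x y, Integrable (fun G => (A.cont G).allocation.q x y) (A.γ₁ x) ∧
    Integrable (fun G => (A.cont G).allocation.t x y) (A.γ₁ x)

/-- The allocation induced by an assessment. -/
noncomputable def allocation (A : Assessment nx ny) : Allocation nx ny where
  q x y := ∫ G, (A.cont G).allocation.q x y ∂(A.γ₁ x)
  t x y := ∫ G, (A.cont G).allocation.t x y ∂(A.γ₁ x)

variable (E : Environment nx ny)

/-- The ex ante distribution of the offered mechanism. -/
noncomputable def offerLaw (A : Assessment nx ny) : Measure Mechanism :=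
  ∑ x, ENNReal.ofReal (E.p₁ x) • A.γ₁ x

/-- No type of seller gains by offering any mechanism, and the play after every offer, on or off
the path, is sequentially rational. -/
def SequentiallyRational (A : Assessment nx ny) : Prop :=
  (∀ x, ∀ G', U₁ E (A.cont G').allocation x ≤ ∫ G, U₁ E (A.cont G).allocation x ∂(A.γ₁ x)) ∧
  ∀ G, (A.cont G).SequentiallyRational E (A.π₁ G)

/-- The buyer's belief after an offer is given by Bayes' rule on the path, that is, it is a
version of the conditional distribution of the seller's type given the offer; it is arbitrary off
the path. The seller's belief after acceptance is consistent for every offer. -/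
def Consistent (A : Assessment nx ny) : Prop :=
  (∀ x, AEMeasurable (fun G => A.π₁ G x) (A.offerLaw E) ∧
    ENNReal.ofReal (E.p₁ x) • A.γ₁ x =
      (A.offerLaw E).withDensity (fun G => ENNReal.ofReal (A.π₁ G x))) ∧
  ∀ G, (A.cont G).Consistent E

/-- Equilibrium of the mechanism-selection game. -/
def IsEquilibrium (A : Assessment nx ny) : Prop :=
  A.OutcomeIntegrable ∧ A.SequentiallyRational E ∧ A.Consistent E

/-- Criterion D1. -/
def PassesD1 (A : Assessment nx ny) : Prop :=
  ∀ G x, (∃ x', x' ≠ x ∧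
    D E A.allocation x G ∪ D0 E A.allocation x G ⊂ D E A.allocation x' G) → A.π₁ G x = 0

end Assessment

end InformedSeller

/-! The equilibrium payoff vector U weakly dominates the payoffs of every allocation that meets the
RSW constraints, and some such allocation attains U. That allocation is therefore RSW, and every RSW
allocation pays U.

Lower bound (`U₁_le_of_RSWConstraints`). By additive separability, two seller types value the same
play differently only through the probability of no trade (`sellerReport_eq`), which higher types
value more. Suppose that the menu value of a monotone rule q exceeds U(x₀), and that for every lower
x the no-trade probability under q is worth more to x₀ than to x by over U(x₀) - U(x). Let x₀ offer
the increments of q as separate units at slightly discounted prices, withholding those that she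
might regret selling. A buyer at least as optimistic as one who is sure of x₀ gives her more than
U(x₀). A more pessimistic buyer trades no more than q does, so x₀ strictly gains whenever a lower
type weakly gains. D1 then excludes all lower types from the buyer's belief; he is optimistic after
all, and the offer is a profitable deviation (`menuValue_le`). Induction on types supplies the
separation hypothesis.

Attainment (`exists_menu_eq`). An offer on the path may pool types, and the buyer's constraints then
hold only on average over his belief. Rearranging the trade probabilities
(`exists_monotone_rearrangement`) makes them monotone in the buyer's type for each seller type in
the support, while keeping the means that matter. The resulting type-revealing menus pay the seller
at least as much on average (`InterimFeasible.exists_menus`) and preserve each type's probability of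
trade, hence her separation from the others. By `menuValue_le`, none of these menus beats U, so each
type in the support gets exactly her menu value. Collecting one menu per type gives the allocation.
-/

namespace InformedSeller

/-! ### One-dimensional screening with finitely many buyer types. -/

section Screening

variable {n : ℕ}

/-- The increments of a function on `Fin n`, with the convention that it vanishes before `0`. -/
def increment (q : Fin n → ℝ) (k : Fin n) : ℝ :=
  q k - if k.val = 0 then 0 else q ⟨k.val - 1, (Nat.sub_le _ _).trans_lt k.isLt⟩

/-- The highest payments that implement `q` for a buyer with valuations `v`. -/
def payment (v q : Fin n → ℝ) (y : Fin n) : ℝ :=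
  ∑ k ∈ Finset.Iic y, increment q k * v k

lemma Iic_fin_succ {m : ℕ} (h : m + 1 < n) :
    Finset.Iic (⟨m + 1, h⟩ : Fin n) =
      insert ⟨m + 1, h⟩ (Finset.Iic (⟨m, (Nat.lt_succ_self m).trans h⟩ : Fin n)) := by
  ext k
  simp only [Finset.mem_Iic, Finset.mem_insert, Fin.le_def, Fin.ext_iff]
  omega

lemma sum_Iic_fin_succ {m : ℕ} (h : m + 1 < n) (f : Fin n → ℝ) :
    ∑ k ∈ Finset.Iic (⟨m + 1, h⟩ : Fin n), f k =
      f ⟨m + 1, h⟩ + ∑ k ∈ Finset.Iic (⟨m, (Nat.lt_succ_self m).trans h⟩ : Fin n), f k := by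
  rw [Iic_fin_succ, Finset.sum_insert]
  simp [Fin.le_def]

lemma sum_Iic_fin_zero (h : 0 < n) (f : Fin n → ℝ) :
    ∑ k ∈ Finset.Iic (⟨0, h⟩ : Fin n), f k = f ⟨0, h⟩ := by
  have : Finset.Iic (⟨0, h⟩ : Fin n) = {⟨0, h⟩} := by
    ext k
    simp [Fin.le_def, Fin.ext_iff]
  rw [this, Finset.sum_singleton]

lemma sum_increment (q : Fin n → ℝ) (y : Fin n) :
    ∑ k ∈ Finset.Iic y, increment q k = q y := by
  obtain ⟨m, hm⟩ := y
  induction m with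
  | zero => rw [sum_Iic_fin_zero]; simp [increment]
  | succ m ih => rw [sum_Iic_fin_succ, ih]; simp [increment]

lemma increment_nonneg {q : Fin n → ℝ} (hq : Monotone q) (h0 : ∀ y, 0 ≤ q y) (k : Fin n) :
    0 ≤ increment q k := by
  unfold increment
  split_ifs with h
  · simpa using h0 k
  · exact sub_nonneg.2 (hq (by simp [Fin.le_def]))

lemma increment_sum {ι : Type*} (s : Finset ι) (a : ι → ℝ) (q : ι → Fin n → ℝ) (k : Fin n) :
    increment (fun y => ∑ i ∈ s, a i * q i y) k = ∑ i ∈ s, a i * increment (q i) k := by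
  unfold increment
  split_ifs <;> simp [mul_sub, Finset.sum_sub_distrib]

lemma payment_sum {ι : Type*} (s : Finset ι) (a : ι → ℝ) (v : Fin n → ℝ) (q : ι → Fin n → ℝ)
    (y : Fin n) :
    payment v (fun y => ∑ i ∈ s, a i * q i y) y = ∑ i ∈ s, a i * payment v (q i) y := by
  simp only [payment, increment_sum, Finset.sum_mul, Finset.mul_sum]
  rw [Finset.sum_comm]
  simp only [mul_assoc]

lemma payment_smul (a : ℝ) (v q : Fin n → ℝ) (y : Fin n) :
    payment v (fun y => a * q y) y = a * payment v q y := by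
  simpa using payment_sum {()} (fun _ => a) v (fun _ => q) y

lemma payment_add_const (b : ℝ) (v q : Fin n → ℝ) (y : Fin n) :
    payment (fun y => b + v y) q y = b * q y + payment v q y := by
  simp only [payment, mul_add, Finset.sum_add_distrib]
  rw [← Finset.sum_mul, sum_increment, mul_comm]

/-- Read `payment` as selling the increment of `q` at each k for the unit price `v k`. The common
index set on the right allows termwise comparison of different y. -/
lemma surplus_eq (c : ℝ) (v q : Fin n → ℝ) (y : Fin n) :
    c * q y - payment v q y = ∑ k, if k ≤ y then increment q k * (c - v k) else 0 := by
  rw [← Finset.sum_filter]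
  have : Finset.univ.filter (fun k => k ≤ y) = Finset.Iic y := by ext; simp
  rw [this, payment]
  simp only [mul_sub, Finset.sum_sub_distrib]
  rw [← Finset.sum_mul, sum_increment, mul_comm]

lemma payment_incentive_compatible {v q : Fin n → ℝ} (hv : Monotone v) (hq : Monotone q)
    (h0 : ∀ y, 0 ≤ q y) (y y' : Fin n) :
    v y * q y' - payment v q y' ≤ v y * q y - payment v q y := by
  rw [surplus_eq, surplus_eq]
  refine Finset.sum_le_sum fun k _ => ?_
  have hk := increment_nonneg hq h0 k
  split_ifs with h1 h2 h2
  · rfl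
  · exact mul_nonpos_of_nonneg_of_nonpos hk (sub_nonpos.2 (hv (not_le.1 h2).le))
  · exact mul_nonneg hk (sub_nonneg.2 (hv h2))
  · rfl

lemma payment_individually_rational {v q : Fin n → ℝ} (hv : Monotone v) (hq : Monotone q)
    (h0 : ∀ y, 0 ≤ q y) (y : Fin n) :
    0 ≤ v y * q y - payment v q y := by
  rw [surplus_eq]
  refine Finset.sum_nonneg fun k _ => ?_
  split_ifs with h
  · exact mul_nonneg (increment_nonneg hq h0 k) (sub_nonneg.2 (hv h))
  · rfl

/-- Only participation of the lowest type and the adjacent downward incentive constraints are used;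
they telescope. -/
lemma le_payment {v q t : Fin n → ℝ}
    (hIC : ∀ y y', v y * q y' - t y' ≤ v y * q y - t y) (hIR : ∀ y, 0 ≤ v y * q y - t y)
    (y : Fin n) : t y ≤ payment v q y := by
  obtain ⟨m, hm⟩ := y
  induction m with
  | zero =>
    rw [payment, sum_Iic_fin_zero]
    have := hIR ⟨0, hm⟩
    simp only [increment, if_true, sub_zero]
    linarith
  | succ m ih =>
    have h1 := ih ((Nat.lt_succ_self m).trans hm)
    have h2 := hIC ⟨m + 1, hm⟩ ⟨m, (Nat.lt_succ_self m).trans hm⟩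
    rw [payment] at h1 ⊢
    rw [sum_Iic_fin_succ]
    simp only [increment, Nat.add_sub_cancel, Nat.succ_ne_zero, if_false] at h1 ⊢
    linarith

lemma monotone_of_incentive_compatible {v q t : Fin n → ℝ} (hv : StrictMono v)
    (hIC : ∀ y y', v y * q y' - t y' ≤ v y * q y - t y) : Monotone q := by
  intro y y' h
  rcases h.eq_or_lt with rfl | h
  · rfl
  by_contra hlt
  have := hv h
  nlinarith [hIC y y', hIC y' y, mul_pos (sub_pos.2 this) (sub_pos.2 (not_le.1 hlt))]

end Screening

/-! ### Monotone rearrangement with prescribed row and column means. -/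

section Rearrangement

lemma eventually_add_mul_mem_Icc {r d : ℝ} (hr : r ∈ Set.Icc (0 : ℝ) 1) (hpos : 0 < d → r < 1)
    (hneg : d < 0 → 0 < r) : ∀ᶠ δ in 𝓝[>] (0 : ℝ), r + δ * d ∈ Set.Icc (0 : ℝ) 1 := by
  have hcont : Tendsto (fun δ : ℝ => r + δ * d) (𝓝[>] 0) (𝓝 r) := by
    have : Continuous fun δ : ℝ => r + δ * d := by fun_prop
    simpa using (this.tendsto 0).mono_left nhdsWithin_le_nhds
  have hδ : ∀ᶠ δ in 𝓝[>] (0 : ℝ), 0 < δ := self_mem_nhdsWithin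
  rcases lt_trichotomy d 0 with h | h | h
  · filter_upwards [hδ, hcont.eventually (lt_mem_nhds (hneg h))] with δ h1 h2
    exact ⟨h2.le, by nlinarith [hr.2, mul_pos h1 (neg_pos.2 h)]⟩
  · simp [h, hr.1, hr.2]
  · filter_upwards [hδ, hcont.eventually (gt_mem_nhds (hpos h))] with δ h1 h2
    exact ⟨by nlinarith [hr.1, mul_pos h1 h], h2.le⟩

variable {ι : Type*} [Fintype ι] {n : ℕ}

/-- A matrix with entries in `[0, 1]` whose weighted column means are monotone can be replaced by
one with monotone rows and the same weighted row and column means. -/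
lemma exists_monotone_rearrangement (a : ι → ℝ) (b : Fin n → ℝ) (ha : ∀ i, 0 ≤ a i)
    (hb : ∀ j, 0 < b j) (q : ι → Fin n → ℝ) (hq : ∀ i j, q i j ∈ Set.Icc (0 : ℝ) 1)
    (hmono : Monotone fun j => ∑ i, a i * q i j) :
    ∃ r : ι → Fin n → ℝ, (∀ i j, r i j ∈ Set.Icc (0 : ℝ) 1) ∧
      (∀ j, ∑ i, a i * r i j = ∑ i, a i * q i j) ∧
      (∀ i, ∑ j, b j * r i j = ∑ j, b j * q i j) ∧
      ∀ i, 0 < a i → Monotone (r i) := by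
  classical
  let F : Set (ι → Fin n → ℝ) := {r | (∀ i j, r i j ∈ Set.Icc (0 : ℝ) 1) ∧
    (∀ j, ∑ i, a i * r i j = ∑ i, a i * q i j) ∧ ∀ i, ∑ j, b j * r i j = ∑ j, b j * q i j}
  have hcube : IsCompact (Set.univ.pi fun _ : ι => Set.univ.pi fun _ : Fin n =>
      Set.Icc (0 : ℝ) 1) :=
    isCompact_univ_pi fun _ => isCompact_univ_pi fun _ => isCompact_Icc
  have hclosed : IsClosed {r : ι → Fin n → ℝ | (∀ j, ∑ i, a i * r i j = ∑ i, a i * q i j) ∧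
      ∀ i, ∑ j, b j * r i j = ∑ j, b j * q i j} := by
    simp only [Set.ofPred_and, Set.ofPred_forall]
    exact (isClosed_iInter fun j => isClosed_eq (by fun_prop) continuous_const).inter
      (isClosed_iInter fun i => isClosed_eq (by fun_prop) continuous_const)
  have hF : IsCompact F := by
    convert hcube.inter_right hclosed using 1
    ext r
    constructor
    · exact fun h => ⟨fun i _ j _ => h.1 i j, h.2⟩
    · exact fun h => ⟨fun i j => h.1 i trivial j trivial, h.2⟩
  -- A minimizer of the weighted sum of squares works: a decreasing pair in a row of positive weight
  -- would allow a feasible perturbation that lowers the sum.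
  obtain ⟨r, ⟨hr01, hrcol, hrrow⟩, hmin⟩ := hF.exists_isMinOn
    (f := fun r => ∑ i, ∑ j, a i * b j * r i j ^ 2) ⟨q, hq, fun _ => rfl, fun _ => rfl⟩
    (by fun_prop)
  refine ⟨r, hr01, hrcol, hrrow, fun x hx y y' hyy => ?_⟩
  by_contra hlt
  rw [not_le] at hlt
  have hney : y ≠ y' := fun h => by simp [h] at hlt
  -- The column means do not fall from y to y', so some other row must compensate for the fall in
  -- row x.
  obtain ⟨x', hx', hlt'⟩ : ∃ x', 0 < a x' ∧ r x' y < r x' y' := by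
    by_contra hcon
    push Not at hcon
    have h1 : ∑ i, a i * r i y' < ∑ i, a i * r i y := by
      refine Finset.sum_lt_sum (fun i _ => ?_) ⟨x, Finset.mem_univ _, by nlinarith⟩
      rcases (ha i).eq_or_lt with h | h
      · simp [← h]
      · exact mul_le_mul_of_nonneg_left (hcon i h) h.le
    rw [hrcol, hrcol] at h1
    exact (hmono hyy).not_gt h1
  have hnex : x ≠ x' := fun h => by subst h; exact hlt.not_gt hlt'
  -- The perturbation `u i * w j` brings the entries at y and y' closer together in both rows. The
  -- inverse weights make all weighted row and column sums of it vanish.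
  let u : ι → ℝ := fun i => (if i = x then (a x)⁻¹ else 0) - if i = x' then (a x')⁻¹ else 0
  let w : Fin n → ℝ := fun j => (if j = y' then (b y')⁻¹ else 0) - if j = y then (b y)⁻¹ else 0
  have hu : ∀ f : ι → ℝ, ∑ i, a i * (f i * u i) = f x - f x' := by
    intro f
    simp only [u, mul_sub, Finset.sum_sub_distrib, mul_ite, mul_zero, Finset.sum_ite_eq',
      Finset.mem_univ, if_true]
    field_simp
  have hw : ∀ f : Fin n → ℝ, ∑ j, b j * (f j * w j) = f y' - f y := by
    intro f
    have h1 := hb y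
    have h2 := hb y'
    simp only [w, mul_sub, Finset.sum_sub_distrib, mul_ite, mul_zero, Finset.sum_ite_eq',
      Finset.mem_univ, if_true]
    field_simp
  -- In each of the two rows the entry that rises is strictly below the one that falls, so neither
  -- is at the bound toward which it moves.
  have hfeas : ∀ i j, ∀ᶠ δ in 𝓝[>] (0 : ℝ), r i j + δ * (u i * w j) ∈ Set.Icc (0 : ℝ) 1 := by
    intro i j
    have p1 := inv_pos.2 hx
    have p2 := inv_pos.2 hx'
    have p3 := inv_pos.2 (hb y)
    have p4 := inv_pos.2 (hb y')
    refine eventually_add_mul_mem_Icc (hr01 i j) ?_ ?_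
    all_goals
      intro hd
      by_contra hcon
      revert hd
      simp only [u, w]
      by_cases e1 : i = x
      · have e1' : i ≠ x' := fun h => hnex (e1.symm.trans h)
        by_cases e2 : j = y'
        · have e2' : j ≠ y := fun h => hney (h.symm.trans e2)
          simp only [e1, e2, hnex, hney.symm, if_true, if_false] at hcon ⊢
          intro hd
          nlinarith [mul_pos p1 p4, (hr01 x y).2, (hr01 x y').1]
        · by_cases e3 : j = y
          · simp only [e1, e3, hnex, hney, if_true, if_false] at hcon ⊢
            intro hd
            nlinarith [mul_pos p1 p3, (hr01 x y).2, (hr01 x y').1]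
          · simp [e2, e3]
      · by_cases e1' : i = x'
        · by_cases e2 : j = y'
          · simp only [e1', e2, hnex.symm, hney.symm, if_true, if_false] at hcon ⊢
            intro hd
            nlinarith [mul_pos p2 p4, (hr01 x' y').2, (hr01 x' y).1]
          · by_cases e3 : j = y
            · simp only [e1', e3, hnex.symm, hney, if_true, if_false] at hcon ⊢
              intro hd
              nlinarith [mul_pos p2 p3, (hr01 x' y').2, (hr01 x' y).1]
            · simp [e2, e3]
        · simp [e1, e1']
  let L : ℝ := ∑ i, ∑ j, a i * b j * (r i j * (u i * w j))
  let M : ℝ := ∑ i, ∑ j, a i * b j * (u i * w j) ^ 2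
  have hL : L < 0 := by
    have h1 : L = ∑ i, a i * ((∑ j, b j * (r i j * w j)) * u i) := by
      simp only [L, Finset.sum_mul, Finset.mul_sum]
      exact Finset.sum_congr rfl fun i _ => Finset.sum_congr rfl fun j _ => by ring
    rw [h1, hu, hw, hw]
    linarith
  have hsmall : ∀ᶠ δ in 𝓝[>] (0 : ℝ), 2 * L + δ * M < 0 := by
    have hc : Continuous fun δ : ℝ => 2 * L + δ * M := by fun_prop
    have : Tendsto (fun δ : ℝ => 2 * L + δ * M) (𝓝[>] 0) (𝓝 (2 * L)) := by
      simpa using (hc.tendsto 0).mono_left nhdsWithin_le_nhds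
    exact this.eventually (gt_mem_nhds (by linarith))
  have hall := eventually_all.2 fun i => eventually_all.2 (hfeas i)
  have hδ : ∀ᶠ δ in 𝓝[>] (0 : ℝ), 0 < δ := self_mem_nhdsWithin
  obtain ⟨δ, h1, h2, h3⟩ := (hδ.and (hsmall.and hall)).exists
  have hmem : (fun i j => r i j + δ * (u i * w j)) ∈ F := by
    refine ⟨h3, fun j => ?_, fun i => ?_⟩
    · have := hu fun _ => δ * w j
      simp only [sub_self] at this
      rw [← hrcol j, ← add_zero (∑ i, a i * r i j), ← this, ← Finset.sum_add_distrib]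
      exact Finset.sum_congr rfl fun i _ => by ring
    · have := hw fun _ => δ * u i
      simp only [sub_self] at this
      rw [← hrrow i, ← add_zero (∑ j, b j * r i j), ← this, ← Finset.sum_add_distrib]
      exact Finset.sum_congr rfl fun i _ => by ring
  have hle := hmin hmem
  have hexp : ∑ i, ∑ j, a i * b j * (r i j + δ * (u i * w j)) ^ 2 =
      ∑ i, ∑ j, a i * b j * r i j ^ 2 + δ * (2 * L + δ * M) := by
    simp only [L, M, Finset.mul_sum, ← Finset.sum_add_distrib]
    exact Finset.sum_congr rfl fun i _ => Finset.sum_congr rfl fun j _ => by ring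
  simp only [Set.mem_ofPred_eq, hexp] at hle
  nlinarith [mul_pos h1 (neg_pos.2 h2)]

end Rearrangement

/-! ### Interim constraints and comparison with type-revealing menus. -/

section Interim

variable {nx ny : ℕ} (E : Environment nx ny)

/-- The seller's probability of trade as evaluated under the prior on the buyer's type. -/
def tradeProb (q : Fin ny → ℝ) : ℝ := ∑ y, E.p₂ y * q y

/-- The payoff of the seller of type `x` if the buyer knows `x` and the allocation rule `q` is
implemented with the highest possible payments. -/
def menuValue (x : Fin nx) (q : Fin ny → ℝ) : ℝ :=
  ∑ y, E.p₂ y * (payment (E.v₂ x) q y + E.v₁ x y * (1 - q y))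

/-- The buyer's interim payoff with belief `π` from reporting `z` when his type is `y`. -/
def interimReport (π : Fin nx → ℝ) (g : Allocation nx ny) (z y : Fin ny) : ℝ :=
  ∑ x, π x * buyerReport E g z x y

/-- The constraints that equilibrium play imposes on an allocation when the buyer's belief
about the seller is `π`. -/
structure InterimFeasible (π : Fin nx → ℝ) (g : Allocation nx ny) : Prop where
  valid : g.Valid
  seller : BICSeller E g
  buyerIC : ∀ y y', interimReport E π g y' y ≤ interimReport E π g y y
  buyerIR : ∀ y, 0 ≤ interimReport E π g y y

variable {E}

lemma sum_p₂ : ∑ y, E.p₂ y = 1 := E.p₂_mem.2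

lemma v₂_strictMono (x : Fin nx) : StrictMono (E.v₂ x) := fun _ _ h =>
  (add_lt_add_iff_left _).2 (E.v22_strictMono h)

/-- The types x and x' value the unsold good differently by an amount that does not depend on y, so
the interim probability of trade is all that matters. -/
lemma sellerReport_eq (g : Allocation nx ny) (x' x : Fin nx) :
    sellerReport E g x' x = U₁ E g x' + (E.v11 x - E.v11 x') * (1 - tradeProb E (g.q x')) := by
  have h : 1 - tradeProb E (g.q x') = ∑ y, E.p₂ y * (1 - g.q x' y) := by
    simp only [tradeProb, mul_sub, mul_one, Finset.sum_sub_distrib, sum_p₂]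
  rw [h, U₁, sellerReport, sellerReport, Finset.mul_sum, ← Finset.sum_add_distrib]
  refine Finset.sum_congr rfl fun y _ => ?_
  simp only [Environment.v₁]
  ring

lemma tradeProb_mem {q : Fin ny → ℝ} (hq : ∀ y, q y ∈ Set.Icc (0 : ℝ) 1) :
    tradeProb E q ∈ Set.Icc (0 : ℝ) 1 := by
  refine ⟨Finset.sum_nonneg fun y _ => mul_nonneg (E.p₂_pos y).le (hq y).1, ?_⟩
  rw [← sum_p₂ (E := E)]
  exact Finset.sum_le_sum fun y _ => mul_le_of_le_one_right (E.p₂_pos y).le (hq y).2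

/-- Separability leaves only row means of `q`, column means of `q`, and column means of the payments
net of `v21`; a rearrangement that keeps the row and column means of `q` thus affects only the net
payments. -/
lemma sum_mul_U₁_eq {π : Fin nx → ℝ} (hπ : ∑ x, π x = 1) (q t : Fin nx → Fin ny → ℝ) :
    ∑ x, π x * ∑ y, E.p₂ y * (t x y + E.v₁ x y * (1 - q x y)) =
      ∑ x, π x * (E.v21 x * tradeProb E (q x) + E.v11 x * (1 - tradeProb E (q x))) +
      ∑ y, E.p₂ y * ((∑ x, π x * (t x y - E.v21 x * q x y)) +
        E.v12 y * (1 - ∑ x, π x * q x y)) := by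
  have h1 : ∀ x, E.v21 x * tradeProb E (q x) + E.v11 x * (1 - tradeProb E (q x)) =
      ∑ y, E.p₂ y * (E.v21 x * q x y + E.v11 x * (1 - q x y)) := by
    intro x
    have : E.v11 x = ∑ y, E.p₂ y * E.v11 x := by rw [← Finset.sum_mul, sum_p₂, one_mul]
    rw [mul_sub, mul_one]
    nth_rewrite 1 [this]
    simp only [tradeProb, Finset.mul_sum, ← Finset.sum_sub_distrib, ← Finset.sum_add_distrib]
    exact Finset.sum_congr rfl fun y _ => by ring
  have h2 : ∀ y, E.p₂ y * ((∑ x, π x * (t x y - E.v21 x * q x y)) +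
      E.v12 y * (1 - ∑ x, π x * q x y)) =
      ∑ x, π x * (E.p₂ y * (t x y - E.v21 x * q x y + E.v12 y * (1 - q x y))) := by
    intro y
    nth_rewrite 1 [← hπ]
    simp only [Finset.mul_sum, ← Finset.sum_sub_distrib, ← Finset.sum_add_distrib]
    exact Finset.sum_congr rfl fun y _ => by ring
  simp only [h1, h2]
  rw [Finset.sum_comm (s := (Finset.univ : Finset (Fin ny)))]
  rw [← Finset.sum_add_distrib]
  refine Finset.sum_congr rfl fun x _ => ?_
  rw [← Finset.mul_sum, ← mul_add, ← Finset.sum_add_distrib]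
  congr 1
  refine Finset.sum_congr rfl fun y _ => ?_
  simp only [Environment.v₁]
  ring

/-- The buyer's interim problem is ordinary screening with valuations `v22`, the mean quantity, and
the mean payment net of the part of his valuation due to the seller's type. -/
lemma interimReport_eq (π : Fin nx → ℝ) (g : Allocation nx ny) (y' y : Fin ny) :
    interimReport E π g y' y = E.v22 y * (∑ x, π x * g.q x y') -
      ∑ x, π x * (g.t x y' - E.v21 x * g.q x y') := by
  simp only [interimReport, buyerReport, Environment.v₂, Finset.mul_sum,
    ← Finset.sum_sub_distrib]
  exact Finset.sum_congr rfl fun y _ => by ring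

/-- The interim feasible allocations do no better for the seller, on average over the buyer's
belief, than some menus that reveal the seller's type and trade with the same probabilities. -/
lemma InterimFeasible.exists_menus {π : Fin nx → ℝ} (hπ : π ∈ stdSimplex ℝ (Fin nx))
    {g : Allocation nx ny} (hg : InterimFeasible E π g) :
    ∃ r : Fin nx → Fin ny → ℝ, (∀ x y, r x y ∈ Set.Icc (0 : ℝ) 1) ∧
      (∀ x, tradeProb E (r x) = tradeProb E (g.q x)) ∧
      (∀ x, 0 < π x → Monotone (r x)) ∧
      ∑ x, π x * U₁ E g x ≤ ∑ x, π x * menuValue E x (r x) := by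
  have hIC : ∀ y y', E.v22 y * (∑ x, π x * g.q x y') -
      ∑ x, π x * (g.t x y' - E.v21 x * g.q x y') ≤ E.v22 y * (∑ x, π x * g.q x y) -
      ∑ x, π x * (g.t x y - E.v21 x * g.q x y) := by
    intro y y'
    rw [← interimReport_eq, ← interimReport_eq]
    exact hg.buyerIC y y'
  have hIR : ∀ y, 0 ≤ E.v22 y * (∑ x, π x * g.q x y) -
      ∑ x, π x * (g.t x y - E.v21 x * g.q x y) := by
    intro y
    rw [← interimReport_eq]
    exact hg.buyerIR y
  obtain ⟨r, hr01, hcol, hrow, hmono⟩ := exists_monotone_rearrangement π E.p₂ hπ.1 E.p₂_pos g.q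
    hg.valid (monotone_of_incentive_compatible E.v22_strictMono hIC)
  refine ⟨r, hr01, hrow, hmono, ?_⟩
  have hpay := le_payment hIC hIR
  have hL := sum_mul_U₁_eq (E := E) hπ.2 g.q g.t
  have hR := sum_mul_U₁_eq (E := E) hπ.2 r fun x => payment (E.v₂ x) (r x)
  have htp : ∀ x, tradeProb E (r x) = tradeProb E (g.q x) := hrow
  simp only [htp, hcol] at hR
  simp only [U₁, sellerReport, menuValue]
  rw [hL, hR]
  -- What remains is to compare net payments. `payment` is linear in the rule, so those of the menus
  -- average to the highest payments for the mean rule, which bound the original ones.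
  refine add_le_add le_rfl (Finset.sum_le_sum fun y _ =>
    mul_le_mul_of_nonneg_left (add_le_add ?_ le_rfl) (E.p₂_pos y).le)
  have h1 : ∀ x, payment (E.v₂ x) (r x) y - E.v21 x * r x y = payment E.v22 (r x) y := by
    intro x
    have : E.v₂ x = fun y => E.v21 x + E.v22 y := rfl
    rw [this, payment_add_const]
    ring
  simp only [h1]
  rw [← payment_sum]
  simp only [hcol]
  exact hpay y

lemma menuValue_smul (x : Fin nx) (a : ℝ) (q : Fin ny → ℝ) :
    menuValue E x (fun y => a * q y) =
      a * menuValue E x q + (1 - a) * ∑ y, E.p₂ y * E.v₁ x y := by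
  simp only [menuValue, payment_smul, Finset.mul_sum, ← Finset.sum_add_distrib]
  exact Finset.sum_congr rfl fun y _ => by ring

lemma U₁_le_menuValue {g : Allocation nx ny} (hIC : EPICBuyer E g) (hIR : EPIRBuyer E g)
    (x : Fin nx) : U₁ E g x ≤ menuValue E x (g.q x) := by
  unfold U₁ sellerReport menuValue
  exact Finset.sum_le_sum fun y _ => mul_le_mul_of_nonneg_left
    (add_le_add (le_payment (v := E.v₂ x) (q := g.q x) (hIC x) (hIR x) y) le_rfl)
    (E.p₂_pos y).le

end Interim

/-! ### Sequential equilibria of continuation games yield interim feasible allocations. -/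

namespace Continuation

variable {nx ny : ℕ} {G : Mechanism} {E : Environment nx ny} {c : Continuation nx ny G}

lemma sum_simplex_mem_Icc {S : Type*} [Fintype S] {σ f : S → ℝ} (hσ : σ ∈ stdSimplex ℝ S)
    (hf : ∀ s, f s ∈ Set.Icc (0 : ℝ) 1) : ∑ s, σ s * f s ∈ Set.Icc (0 : ℝ) 1 := by
  refine ⟨Finset.sum_nonneg fun s _ => mul_nonneg (hσ.1 s) (hf s).1, ?_⟩
  rw [← hσ.2]
  exact Finset.sum_le_sum fun s _ => mul_le_of_le_one_right (hσ.1 s) (hf s).2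

lemma allocation_valid (c : Continuation nx ny G) : c.allocation.Valid := by
  intro x y
  have h1 : ∑ s₁, ∑ s₂, c.σ₁ x s₁ * c.σ₂ y s₂ * G.q s₁ s₂ =
      ∑ s₁, c.σ₁ x s₁ * ∑ s₂, c.σ₂ y s₂ * G.q s₁ s₂ := by
    simp only [Finset.mul_sum, mul_assoc]
  have h2 := sum_simplex_mem_Icc (c.σ₁_mem x) fun s₁ =>
    sum_simplex_mem_Icc (c.σ₂_mem y) fun s₂ => G.q_mem s₁ s₂
  rw [← h1] at h2
  exact ⟨mul_nonneg (c.γ₂_mem y).1 h2.1, mul_le_one₀ (c.γ₂_mem y).2 h2.1 h2.2⟩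

lemma acceptance_mul_buyerPayoff (π : Fin nx → ℝ) (y' y : Fin ny) :
    c.γ₂ y' * c.buyerPayoff E π y (c.σ₂ y') = interimReport E π c.allocation y' y := by
  simp only [buyerPayoff, interimReport, buyerReport, allocation, Finset.mul_sum,
    ← Finset.sum_sub_distrib]
  exact Finset.sum_congr rfl fun x _ => Finset.sum_congr rfl fun s₁ _ =>
    Finset.sum_congr rfl fun s₂ _ => by ring

/-- The seller's belief after acceptance is the posterior, if acceptance has positive
probability. -/
lemma Consistent.posterior (h : c.Consistent E) (y : Fin ny) :
    c.π₂ y * ∑ y', E.p₂ y' * c.γ₂ y' = E.p₂ y * c.γ₂ y := by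
  obtain ⟨a, ha, hγ, hπ⟩ := h
  have hS : Tendsto (fun k => ∑ y', E.p₂ y' * a k y') atTop (𝓝 (∑ y', E.p₂ y' * c.γ₂ y')) :=
    tendsto_finsetSum _ fun y' _ => (hγ y').const_mul _
  have h1 := (hπ y).mul hS
  have h2 := (hγ y).const_mul (E.p₂ y)
  refine tendsto_nhds_unique h1 (h2.congr fun k => ?_)
  have : 0 < ∑ y', E.p₂ y' * a k y' :=
    Finset.sum_pos (fun y' _ => mul_pos (E.p₂_pos y') (ha k y').1) ⟨y, Finset.mem_univ _⟩
  field_simp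

/-- Multiplying by the acceptance probability turns the posterior into the prior and also covers the
case of certain rejection. The rejection term does not depend on the action, so optimality after
acceptance implies interim incentive compatibility. -/
lemma sum_mul_sellerPayoff (h : c.Consistent E) (x' x : Fin nx) :
    (∑ y, E.p₂ y * c.γ₂ y) * c.sellerPayoff E x (c.σ₁ x') +
      ∑ y, E.p₂ y * ((1 - c.γ₂ y) * E.v₁ x y) = sellerReport E c.allocation x' x := by
  have h1 : ∀ y, ∑ s₁, ∑ s₂, c.σ₁ x' s₁ * c.σ₂ y s₂ * (G.t s₁ s₂ + E.v₁ x y * (1 - G.q s₁ s₂)) =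
      (∑ s₁, ∑ s₂, c.σ₁ x' s₁ * c.σ₂ y s₂ * G.t s₁ s₂) + E.v₁ x y *
        (1 - ∑ s₁, ∑ s₂, c.σ₁ x' s₁ * c.σ₂ y s₂ * G.q s₁ s₂) := by
    intro y
    have hone : ∑ s₁, ∑ s₂, c.σ₁ x' s₁ * c.σ₂ y s₂ = 1 := by
      simp only [← Finset.mul_sum, (c.σ₂_mem y).2, mul_one, (c.σ₁_mem x').2]
    nth_rewrite 2 [← hone]
    simp only [Finset.mul_sum, ← Finset.sum_sub_distrib, ← Finset.sum_add_distrib]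
    exact Finset.sum_congr rfl fun s₁ _ => Finset.sum_congr rfl fun s₂ _ => by ring
  rw [sellerPayoff, Finset.mul_sum, sellerReport, ← Finset.sum_add_distrib]
  refine Finset.sum_congr rfl fun y _ => ?_
  rw [h1, ← mul_assoc, mul_comm (∑ y, E.p₂ y * c.γ₂ y), h.posterior y]
  simp only [allocation]
  ring

lemma IsSequentialEquilibrium.interimFeasible {π : Fin nx → ℝ}
    (h : c.IsSequentialEquilibrium E π) : InterimFeasible E π c.allocation where
  valid := c.allocation_valid
  seller x x' := by
    rw [U₁, ← sum_mul_sellerPayoff h.2, ← sum_mul_sellerPayoff h.2]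
    refine add_le_add (mul_le_mul_of_nonneg_left (h.1.1 x _ (c.σ₁_mem x')) ?_) le_rfl
    exact Finset.sum_nonneg fun y _ => mul_nonneg (E.p₂_pos y).le (c.γ₂_mem y).1
  buyerIC y y' := by
    rw [← acceptance_mul_buyerPayoff, ← acceptance_mul_buyerPayoff]
    exact (mul_le_mul_of_nonneg_left (h.1.2.1 y _ (c.σ₂_mem y')) (c.γ₂_mem y').1).trans
      (h.1.2.2 y _ (c.γ₂_mem y'))
  buyerIR y := by
    rw [← acceptance_mul_buyerPayoff]
    simpa using h.1.2.2 y 0 (by simp)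

end Continuation

/-! ### Menus: equilibrium responses and their connectedness. -/

section Menus

variable {nx ny : ℕ} (E : Environment nx ny) {S : Type} [Fintype S] [Nonempty S]

/-- The mechanism in which the buyer chooses an item and the seller is inactive. -/
abbrev menu (q t : S → ℝ) (hq : ∀ s, q s ∈ Set.Icc (0 : ℝ) 1) : Mechanism where
  S₁ := Unit
  S₂ := S
  q _ s := q s
  t _ s := t s
  q_mem _ s := hq s

/-- The allocation that results when the buyer of type `y` chooses from a menu according
to `ρ y`. -/
def menuOutcome (q t : S → ℝ) (ρ : Fin ny → S → ℝ) : Allocation nx ny where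
  q _ y := ∑ s, ρ y s * q s
  t _ y := ∑ s, ρ y s * t s

/-- The choices `ρ` are optimal for a buyer who expects the seller's type to contribute `b` to
his valuation. -/
def IsMenuResponse (q t : S → ℝ) (b : ℝ) (ρ : Fin ny → S → ℝ) : Prop :=
  (∀ y, ρ y ∈ stdSimplex ℝ S) ∧ ∀ y s,
    (b + E.v22 y) * q s - t s ≤ ∑ r, ρ y r * ((b + E.v22 y) * q r - t r)

/-- The expected contribution of the seller's type to the buyer's valuation. -/
def meanValue (π : Fin nx → ℝ) : ℝ := ∑ x, π x * E.v21 x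

variable {E} {q t : S → ℝ} {hq : ∀ s, q s ∈ Set.Icc (0 : ℝ) 1}

lemma meanValue_single (x : Fin nx) : meanValue E (Pi.single x 1) = E.v21 x := by
  simp [meanValue, Pi.single_apply]

lemma le_meanValue {π : Fin nx → ℝ} (hπ : π ∈ stdSimplex ℝ (Fin nx)) {x₀ : Fin nx}
    (h : ∀ x < x₀, π x = 0) : E.v21 x₀ ≤ meanValue E π := by
  rw [← one_mul (E.v21 x₀), ← hπ.2, Finset.sum_mul]
  refine Finset.sum_le_sum fun x _ => ?_
  rcases lt_or_ge x x₀ with hx | hx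
  · simp [h x hx]
  · exact mul_le_mul_of_nonneg_left (E.v21_mono hx) (hπ.1 x)

lemma menu_σ₁ (c : Continuation nx ny (menu q t hq)) (x : Fin nx) (s : (menu q t hq).S₁) :
    c.σ₁ x s = 1 :=
  (Fintype.sum_unique (ι := Unit) (c.σ₁ x)).symm.trans (c.σ₁_mem x).2

lemma menu_allocation (c : Continuation nx ny (menu q t hq)) :
    c.allocation = ⟨fun _ y => c.γ₂ y * ∑ s : S, c.σ₂ y s * q s,
      fun _ y => c.γ₂ y * ∑ s : S, c.σ₂ y s * t s⟩ := by
  have hu : ∀ f : (menu q t hq).S₁ → ℝ, ∑ s, f s = f () := fun f =>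
    (Fintype.sum_unique (ι := Unit) f)
  simp only [Continuation.allocation, hu, menu_σ₁, one_mul]

/-- With an inactive seller, the belief matters only through the single number `meanValue`. -/
lemma menu_buyerPayoff (c : Continuation nx ny (menu q t hq)) {π : Fin nx → ℝ}
    (hπ : ∑ x, π x = 1) (y : Fin ny) (τ : S → ℝ) :
    c.buyerPayoff E π y τ = ∑ s, τ s * ((meanValue E π + E.v22 y) * q s - t s) := by
  have hu : ∀ f : (menu q t hq).S₁ → ℝ, ∑ s, f s = f () := fun f =>
    (Fintype.sum_unique (ι := Unit) f)
  simp only [Continuation.buyerPayoff, hu, menu_σ₁, one_mul]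
  change ∑ x, π x * ∑ s : S, τ s * (E.v₂ x y * q s - t s) = _
  simp only [Finset.mul_sum]
  rw [Finset.sum_comm]
  refine Finset.sum_congr rfl fun s _ => ?_
  have h1 : (meanValue E π + E.v22 y) * q s - t s = ∑ x, π x * (E.v₂ x y * q s - t s) := by
    have h2 : ∑ x, π x * (E.v₂ x y * q s - t s) =
        (∑ x, π x * E.v21 x + (∑ x, π x) * E.v22 y) * q s - (∑ x, π x) * t s := by
      simp only [Finset.sum_mul, ← Finset.sum_add_distrib, ← Finset.sum_sub_distrib,
        Environment.v₂]
      exact Finset.sum_congr rfl fun x _ => by ring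
    rw [h2, hπ, meanValue, one_mul, one_mul]
  rw [h1, Finset.mul_sum]
  exact Finset.sum_congr rfl fun x _ => by ring

/-- The acceptance of a menu by everyone, followed by the choices `ρ`. -/
def menuContinuation (E : Environment nx ny) {q t : S → ℝ}
    (hq : ∀ s, q s ∈ Set.Icc (0 : ℝ) 1) (ρ : Fin ny → S → ℝ)
    (hρ : ∀ y, ρ y ∈ stdSimplex ℝ S) : Continuation nx ny (menu q t hq) where
  γ₂ _ := 1
  σ₁ _ _ := 1
  σ₂ := ρ
  π₂ := E.p₂
  γ₂_mem _ := by simp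
  σ₁_mem _ := ⟨fun _ => zero_le_one, Fintype.sum_unique (ι := Unit) _⟩
  σ₂_mem := hρ
  π₂_mem := E.p₂_mem

/-- The null item e replicates rejection, so universal acceptance is optimal. Trembles that are
equal across buyer types keep the seller's belief at the prior. -/
lemma menuOutcome_mem_BR {π : Fin nx → ℝ} (hπ : π ∈ stdSimplex ℝ (Fin nx)) {e : S}
    (hqe : q e = 0) (hte : t e = 0) {ρ : Fin ny → S → ℝ}
    (hρ : IsMenuResponse E q t (meanValue E π) ρ) :
    menuOutcome q t ρ ∈ BR E π (menu q t hq) := by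
  refine ⟨menuContinuation E hq ρ hρ.1, ⟨⟨fun x τ hτ => ?_, fun y τ hτ => ?_, fun y a ha => ?_⟩,
    fun k _ => 1 - 1 / ((k : ℝ) + 2), fun k _ => ?_, fun _ => ?_, fun y => ?_⟩, ?_⟩
  · have : τ = fun _ => 1 := by
      funext s
      exact (Fintype.sum_unique (ι := Unit) τ).symm.trans hτ.2
    rw [this]
    exact le_rfl
  · rw [menu_buyerPayoff _ hπ.2, menu_buyerPayoff _ hπ.2]
    calc ∑ s : S, τ s * ((meanValue E π + E.v22 y) * q s - t s)
        ≤ ∑ s : S, τ s * ∑ s', ρ y s' * ((meanValue E π + E.v22 y) * q s' - t s') :=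
          Finset.sum_le_sum fun s _ => mul_le_mul_of_nonneg_left (hρ.2 y s) (hτ.1 s)
      _ = ∑ s', ρ y s' * ((meanValue E π + E.v22 y) * q s' - t s') := by
          have h : ∑ s : S, τ s = 1 := hτ.2
          rw [← Finset.sum_mul, h, one_mul]
  · refine mul_le_mul_of_nonneg_right ha.2 ?_
    rw [menu_buyerPayoff _ hπ.2]
    have h := hρ.2 y e
    rw [hqe, hte, mul_zero, sub_zero] at h
    exact h
  · have : (0 : ℝ) < k + 2 := by positivity
    have h1 : 1 / ((k : ℝ) + 2) < 1 := by rw [div_lt_one this]; linarith [k.cast_nonneg (α := ℝ)]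
    have h2 : 0 < 1 / ((k : ℝ) + 2) := by positivity
    constructor <;> linarith
  · have h := (tendsto_one_div_add_atTop_nhds_zero_nat (𝕜 := ℝ)).comp (tendsto_add_atTop_nat 1)
    have h' : Tendsto (fun k : ℕ => 1 - 1 / ((k : ℝ) + 2)) atTop (𝓝 (1 - 0)) := by
      refine tendsto_const_nhds.sub (h.congr fun k => ?_)
      simp only [Function.comp, Nat.cast_add, Nat.cast_one, add_assoc]
      norm_num
    rw [sub_zero] at h'
    exact h'
  · refine tendsto_const_nhds.congr fun k => ?_
    have : (1 - 1 / ((k : ℝ) + 2)) ≠ 0 := by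
      have : (0 : ℝ) < k + 2 := by positivity
      have h1 : 1 / ((k : ℝ) + 2) < 1 := by
        rw [div_lt_one this]; linarith [k.cast_nonneg (α := ℝ)]
      linarith
    rw [← Finset.sum_mul, sum_p₂, one_mul, mul_div_assoc, div_self this, mul_one]
    rfl
  · rw [menu_allocation]
    simp [menuContinuation, menuOutcome]

/-- Conversely, the probability of rejection can be moved to the null item e. -/
lemma exists_menuResponse_of_mem_BR {π : Fin nx → ℝ} (hπ : π ∈ stdSimplex ℝ (Fin nx)) {e : S}
    (hqe : q e = 0) (hte : t e = 0) {g : Allocation nx ny} (hg : g ∈ BR E π (menu q t hq)) :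
    ∃ ρ, IsMenuResponse E q t (meanValue E π) ρ ∧ g = menuOutcome q t ρ := by
  classical
  obtain ⟨c, ⟨⟨-, h2, h3⟩, -⟩, rfl⟩ := hg
  let ρ : Fin ny → S → ℝ := fun y s =>
    c.γ₂ y * c.σ₂ y s + (1 - c.γ₂ y) * (Pi.single e 1 : S → ℝ) s
  have hsum : ∀ y (f : S → ℝ),
      ∑ s, ρ y s * f s = c.γ₂ y * (∑ s : S, c.σ₂ y s * f s) + (1 - c.γ₂ y) * f e := by
    intro y f
    simp [ρ, add_mul, Finset.sum_add_distrib, Finset.mul_sum, mul_assoc, Pi.single_apply]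
  refine ⟨ρ, ⟨fun y => ⟨fun s => ?_, ?_⟩, fun y s => ?_⟩, ?_⟩
  · have h1 : 0 ≤ (Pi.single e 1 : S → ℝ) s := by
      rw [Pi.single_apply]; split_ifs <;> norm_num
    exact add_nonneg (mul_nonneg (c.γ₂_mem y).1 ((c.σ₂_mem y).1 s))
      (mul_nonneg (sub_nonneg.2 (c.γ₂_mem y).2) h1)
  · have h1 : ∑ s : S, c.σ₂ y s = 1 := (c.σ₂_mem y).2
    have := hsum y fun _ => 1
    simp only [mul_one, h1] at this
    rw [this]
    ring
  · rw [hsum, hqe, hte]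
    have h4 := h2 y (Pi.single s 1 : S → ℝ) (single_mem_stdSimplex ℝ s)
    have h5 := h3 y 1 (by simp)
    rw [menu_buyerPayoff c hπ.2, menu_buyerPayoff c hπ.2] at h4
    rw [menu_buyerPayoff c hπ.2] at h5
    simp only [Pi.single_apply, ite_mul, one_mul, zero_mul, Finset.sum_ite_eq',
      Finset.mem_univ, if_true] at h4
    linarith
  · rw [menu_allocation]
    simp only [menuOutcome, hsum, hqe, hte, mul_zero, add_zero]

lemma exists_menuResponse (q t : S → ℝ) (b : ℝ) : ∃ ρ, IsMenuResponse E q t b ρ := by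
  classical
  have h : ∀ y, ∃ s, ∀ s', (b + E.v22 y) * q s' - t s' ≤ (b + E.v22 y) * q s - t s := fun y =>
    Finite.exists_max fun s => (b + E.v22 y) * q s - t s
  choose s hs using h
  refine ⟨fun y => Pi.single (s y) 1, fun y => single_mem_stdSimplex ℝ _, fun y s' => ?_⟩
  simpa [Pi.single_apply] using hs y s'

lemma convex_menuResponses {S : Type} [Fintype S] (q t : S → ℝ) (b : ℝ) :
    Convex ℝ {ρ | IsMenuResponse E q t b ρ} := by
  rintro ρ hρ ρ' hρ' α α' hα hα' hsum
  refine ⟨fun y => convex_stdSimplex ℝ S (hρ.1 y) (hρ'.1 y) hα hα' hsum, fun y r => ?_⟩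
  have h1 := mul_le_mul_of_nonneg_left (hρ.2 y r) hα
  have h2 := mul_le_mul_of_nonneg_left (hρ'.2 y r) hα'
  calc _ = α * ((b + E.v22 y) * q r - t r) + α' * ((b + E.v22 y) * q r - t r) := by
        rw [← add_mul, hsum, one_mul]
    _ ≤ _ := add_le_add h1 h2
    _ = _ := by
        simp only [Finset.mul_sum, ← Finset.sum_add_distrib, Pi.add_apply, Pi.smul_apply,
          smul_eq_mul]
        exact Finset.sum_congr rfl fun _ _ => by ring

/-- The responses to a menu along a segment of expectations form a connected set. -/
lemma isPreconnected_menuResponses (q t : S → ℝ) (b b' : ℝ) :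
    IsPreconnected {z : ℝ × (Fin ny → S → ℝ) | z.1 ∈ Set.Icc (0 : ℝ) 1 ∧
      IsMenuResponse E q t ((1 - z.1) * b + z.1 * b') z.2} := by
  set Z := {z : ℝ × (Fin ny → S → ℝ) | z.1 ∈ Set.Icc (0 : ℝ) 1 ∧
      IsMenuResponse E q t ((1 - z.1) * b + z.1 * b') z.2} with hZ
  have hcompact : IsCompact Z := by
    have h1 : IsCompact ((Set.Icc (0 : ℝ) 1) ×ˢ
        (Set.univ.pi fun _ : Fin ny => stdSimplex ℝ S)) :=
      isCompact_Icc.prod (isCompact_univ_pi fun _ => isCompact_stdSimplex ℝ S)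
    have h2 : IsClosed {z : ℝ × (Fin ny → S → ℝ) | ∀ y s,
        ((1 - z.1) * b + z.1 * b' + E.v22 y) * q s - t s ≤
          ∑ s', z.2 y s' * (((1 - z.1) * b + z.1 * b' + E.v22 y) * q s' - t s')} := by
      simp only [Set.ofPred_forall]
      exact isClosed_iInter fun y => isClosed_iInter fun s =>
        isClosed_le (by fun_prop) (by fun_prop)
    convert h1.inter_right h2 using 1
    ext z
    constructor
    · exact fun h => ⟨⟨h.1, fun y _ => h.2.1 y⟩, h.2.2⟩
    · exact fun h => ⟨h.1.1, fun y => h.1.2 y trivial, h.2⟩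
  rw [isPreconnected_closed_iff]
  rintro A B hA hB hAB ⟨zA, hzA⟩ ⟨zB, hzB⟩
  -- Compactness makes the projections of the two closed pieces closed, and existence of responses
  -- makes them cover the interval. Hence some fiber meets both pieces, and that fiber is convex.
  have hproj := isPreconnected_closed_iff.1 (isPreconnected_Icc (a := (0 : ℝ)) (b := 1))
    (Prod.fst '' (Z ∩ A)) (Prod.fst '' (Z ∩ B))
    ((hcompact.inter_right hA).image continuous_fst).isClosed
    ((hcompact.inter_right hB).image continuous_fst).isClosed
    (by
      intro s hs
      obtain ⟨ρ, hρ⟩ := exists_menuResponse (E := E) q t ((1 - s) * b + s * b')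
      have hz : (s, ρ) ∈ Z := ⟨hs, hρ⟩
      rcases hAB hz with h | h
      · exact Or.inl ⟨_, ⟨hz, h⟩, rfl⟩
      · exact Or.inr ⟨_, ⟨hz, h⟩, rfl⟩)
    ⟨zA.1, hzA.1.1, _, hzA, rfl⟩ ⟨zB.1, hzB.1.1, _, hzB, rfl⟩
  obtain ⟨s, hs, ⟨⟨_, ρA⟩, hρA, rfl⟩, ⟨⟨s, ρB⟩, hρB, rfl⟩⟩ := hproj
  dsimp only at hρA hs
  have hfib := isPreconnected_closed_iff.1 
    (convex_menuResponses (E := E) q t ((1 - s) * b + s * b')).isPreconnected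
    ((fun ρ => (s, ρ)) ⁻¹' A) ((fun ρ => (s, ρ)) ⁻¹' B)
    (hA.preimage (by fun_prop)) (hB.preimage (by fun_prop))
    (fun ρ hρ => hAB ⟨hs, hρ⟩) ⟨ρA, hρA.1.2, hρA.2⟩ ⟨ρB, hρB.1.2, hρB.2⟩
  obtain ⟨ρ, hρ, h⟩ := hfib
  exact ⟨(s, ρ), ⟨hs, hρ⟩, h⟩

/-- Every payoff of the seller between those from two responses is the payoff from a response
under some intermediate belief. -/
lemma exists_menuResponse_payoff_eq {π π' : Fin nx → ℝ} (hπ : π ∈ stdSimplex ℝ (Fin nx))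
    (hπ' : π' ∈ stdSimplex ℝ (Fin nx)) {ρ ρ' : Fin ny → S → ℝ}
    (hρ : IsMenuResponse E q t (meanValue E π) ρ)
    (hρ' : IsMenuResponse E q t (meanValue E π') ρ') {x : Fin nx} {u : ℝ}
    (hu : U₁ E (menuOutcome q t ρ) x ≤ u) (hu' : u ≤ U₁ E (menuOutcome q t ρ') x) :
    ∃ π'' ∈ stdSimplex ℝ (Fin nx), ∃ ρ'', IsMenuResponse E q t (meanValue E π'') ρ'' ∧
      U₁ E (menuOutcome q t ρ'') x = u := by
  have hconn := isPreconnected_menuResponses (E := E) q t (meanValue E π) (meanValue E π')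
  have hcont : Continuous fun z : ℝ × (Fin ny → S → ℝ) => U₁ E (menuOutcome q t z.2) x := by
    unfold U₁ sellerReport menuOutcome
    fun_prop
  obtain ⟨⟨s, ρ''⟩, ⟨hs, h⟩, hval⟩ := hconn.intermediate_value
    (a := (0, ρ)) (b := (1, ρ')) (by simpa using hρ) (by simpa using hρ') hcont.continuousOn
    ⟨hu, hu'⟩
  -- `meanValue` is linear, so the intermediate expectation is that of the mixed belief.
  refine ⟨(1 - s) • π + s • π', convex_stdSimplex ℝ _ hπ hπ' (sub_nonneg.2 hs.2) hs.1 (by ring),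
    ρ'', ?_, hval⟩
  convert h using 1
  simp [meanValue, add_mul, Finset.sum_add_distrib, Finset.mul_sum, mul_assoc]

lemma U₁_menuOutcome_sub {S : Type} [Fintype S] (q t : S → ℝ) (ρ : Fin ny → S → ℝ) (x x' : Fin nx) :
    U₁ E (menuOutcome q t ρ) x = U₁ E (menuOutcome q t ρ) x' +
      (E.v11 x - E.v11 x') * (1 - tradeProb E fun y => ∑ s, ρ y s * q s) :=
  sellerReport_eq (E := E) (menuOutcome q t ρ) x' x

end Menus

/-! ### Menus of separately priced units. -/

section Bundles

variable {nx ny : ℕ} {E : Environment nx ny}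

/-- The total of `f` over a bundle. -/
def bundleSum {n : ℕ} (f : Fin n → ℝ) (K : Finset (Fin n)) : ℝ := ∑ k ∈ K, f k

/-- The probability that a random bundle contains `k`. -/
def inclusionProb {n : ℕ} (τ : Finset (Fin n) → ℝ) (k : Fin n) : ℝ :=
  ∑ K, τ K * if k ∈ K then 1 else 0

lemma sum_mul_bundleSum {n : ℕ} (τ : Finset (Fin n) → ℝ) (f : Fin n → ℝ) :
    ∑ K, τ K * bundleSum f K = ∑ k, inclusionProb τ k * f k := by
  simp only [inclusionProb, Finset.sum_mul]
  rw [Finset.sum_comm]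
  refine Finset.sum_congr rfl fun K _ => ?_
  simp [bundleSum, Finset.mul_sum]

lemma inclusionProb_mem {n : ℕ} {τ : Finset (Fin n) → ℝ}
    (hτ : τ ∈ stdSimplex ℝ (Finset (Fin n))) (k : Fin n) :
    inclusionProb τ k ∈ Set.Icc (0 : ℝ) 1 :=
  Continuation.sum_simplex_mem_Icc hτ fun K => by split_ifs <;> simp

/-- A buyer who may choose any bundle of quantities `Δ k` at unit prices `p k` buys those whose
price is below his valuation, and none whose price is above it. -/
lemma inclusionProb_mul_eq {Δ p : Fin ny → ℝ} {b : ℝ} {ρ : Fin ny → Finset (Fin ny) → ℝ}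
    (hρ : IsMenuResponse E (bundleSum Δ) (bundleSum fun k => Δ k * p k) b ρ) (y k : Fin ny) :
    inclusionProb (ρ y) k * (Δ k * (b + E.v22 y - p k)) =
      max (Δ k * (b + E.v22 y - p k)) 0 := by
  classical
  set f : Fin ny → ℝ := fun k => Δ k * (b + E.v22 y - p k) with hf
  have hbs : ∀ K, (b + E.v22 y) * bundleSum Δ K - bundleSum (fun k => Δ k * p k) K =
      bundleSum f K := by
    intro K
    simp only [bundleSum, Finset.mul_sum, ← Finset.sum_sub_distrib, hf]
    exact Finset.sum_congr rfl fun k _ => by ring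
  -- The bundle of all profitable units attains the termwise upper bound, so optimality forces
  -- equality in every term.
  have h := hρ.2 y (Finset.univ.filter fun k => 0 < f k)
  simp only [hbs] at h
  rw [sum_mul_bundleSum] at h
  have hmax : bundleSum f (Finset.univ.filter fun k => 0 < f k) = ∑ k, max (f k) 0 := by
    rw [bundleSum, Finset.sum_filter]
    refine Finset.sum_congr rfl fun k _ => ?_
    split_ifs with h
    · rw [max_eq_left h.le]
    · rw [max_eq_right (not_lt.1 h)]
  rw [hmax] at h
  have hle : ∀ k ∈ Finset.univ, inclusionProb (ρ y) k * f k ≤ max (f k) 0 := by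
    intro k _
    have hw := inclusionProb_mem (hρ.1 y) k
    rcases le_total 0 (f k) with h | h
    · exact (mul_le_of_le_one_left h hw.2).trans (le_max_left _ _)
    · exact (mul_nonpos_of_nonneg_of_nonpos hw.1 h).trans (le_max_right _ _)
  exact (Finset.sum_eq_sum_iff_of_le hle).1 (le_antisymm (Finset.sum_le_sum hle) h) k
    (Finset.mem_univ k)

/-- The no-trade payoff plus the margin on each unit sold, in the same layout as `menuValue_eq` so
that the two can be compared unit by unit. -/
lemma U₁_bundle_eq (Δ p : Fin ny → ℝ) (ρ : Fin ny → Finset (Fin ny) → ℝ) (x : Fin nx) :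
    U₁ E (menuOutcome (bundleSum Δ) (bundleSum fun k => Δ k * p k) ρ) x =
      ∑ y, E.p₂ y * E.v₁ x y +
      ∑ k, ∑ y, E.p₂ y * (inclusionProb (ρ y) k * Δ k * (p k - E.v₁ x y)) := by
  rw [U₁, sellerReport, Finset.sum_comm, ← Finset.sum_add_distrib]
  refine Finset.sum_congr rfl fun y _ => ?_
  simp only [menuOutcome, sum_mul_bundleSum]
  rw [← Finset.mul_sum, ← mul_add]
  congr 1
  rw [mul_sub, mul_one, Finset.mul_sum, add_comm, sub_add_eq_add_sub, add_sub_assoc,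
    ← Finset.sum_sub_distrib]
  congr 1
  exact Finset.sum_congr rfl fun k _ => by ring

lemma menuValue_eq (x : Fin nx) (q : Fin ny → ℝ) :
    menuValue E x q = ∑ y, E.p₂ y * E.v₁ x y +
      ∑ k, ∑ y, E.p₂ y * if k ≤ y then increment q k * (E.v₂ x k - E.v₁ x y) else 0 := by
  rw [Finset.sum_comm, ← Finset.sum_add_distrib]
  refine Finset.sum_congr rfl fun y _ => ?_
  have h := surplus_eq (E.v₁ x y) (E.v₂ x) q y
  rw [← Finset.mul_sum, ← mul_add]
  congr 1
  have h2 : ∑ k, (if k ≤ y then increment q k * (E.v₂ x k - E.v₁ x y) else 0) =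
      -∑ k, if k ≤ y then increment q k * (E.v₁ x y - E.v₂ x k) else 0 := by
    rw [← Finset.sum_neg_distrib]
    exact Finset.sum_congr rfl fun k _ => by split_ifs <;> ring
  rw [h2, ← h]
  ring

lemma sum_increment_le_one {n : ℕ} {q : Fin n → ℝ} (hq : ∀ y, q y ∈ Set.Icc (0 : ℝ) 1) :
    ∑ k, increment q k ≤ 1 := by
  rcases n with _ | n
  · simp
  · have h : (Finset.univ : Finset (Fin (n + 1))) = Finset.Iic (Fin.last n) := by
      ext k; simp [Fin.le_last]
    rw [h, sum_increment]
    exact (hq _).2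

open Classical in
/-- The increments of `q` that the seller of type `x` is willing to sell, at the highest prices
compatible with `q`, even to the buyer types for which they are not intended. -/
noncomputable def robustIncrement (E : Environment nx ny) (x : Fin nx) (q : Fin ny → ℝ)
    (k : Fin ny) : ℝ :=
  if ∀ y < k, E.v₁ x y ≤ E.v₂ x k then increment q k else 0

/-- Prices slightly below those that extract the surplus of the marginal buyer types. -/
def discountPrice (E : Environment nx ny) (x : Fin nx) (ε : ℝ) (k : Fin ny) : ℝ := E.v₂ x k - ε

section Robust

variable {q : Fin ny → ℝ}

lemma robustIncrement_mem (hq : Monotone q) (h01 : ∀ y, q y ∈ Set.Icc (0 : ℝ) 1) (x : Fin nx)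
    (k : Fin ny) : robustIncrement E x q k ∈ Set.Icc 0 (increment q k) := by
  have := increment_nonneg hq (fun y => (h01 y).1) k
  unfold robustIncrement
  split_ifs <;> simp [this]

lemma bundleSum_robust_mem (hq : Monotone q) (h01 : ∀ y, q y ∈ Set.Icc (0 : ℝ) 1) (x : Fin nx)
    (K : Finset (Fin ny)) : bundleSum (robustIncrement E x q) K ∈ Set.Icc (0 : ℝ) 1 := by
  have h := robustIncrement_mem (E := E) hq h01 x
  refine ⟨Finset.sum_nonneg fun k _ => (h k).1, ?_⟩
  calc bundleSum (robustIncrement E x q) K ≤ ∑ k, robustIncrement E x q k :=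
        Finset.sum_le_sum_of_subset_of_nonneg (Finset.subset_univ K) fun k _ _ => (h k).1
    _ ≤ ∑ k, increment q k := Finset.sum_le_sum fun k _ => (h k).2
    _ ≤ 1 := sum_increment_le_one h01

/-- A buyer who is at least as optimistic as a buyer who knows that the seller is of type `x`
makes her at least as well off as the menu value of `q`, up to the discount. -/
lemma menuValue_le_of_optimistic (hq : Monotone q) (h01 : ∀ y, q y ∈ Set.Icc (0 : ℝ) 1)
    {x : Fin nx} {ε b : ℝ} (hε : 0 < ε) (hb : E.v21 x ≤ b) {ρ : Fin ny → Finset (Fin ny) → ℝ}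
    (hρ : IsMenuResponse E (bundleSum (robustIncrement E x q))
      (bundleSum fun k => robustIncrement E x q k * discountPrice E x ε k) b ρ) :
    menuValue E x q - ε ≤ U₁ E (menuOutcome (bundleSum (robustIncrement E x q))
      (bundleSum fun k => robustIncrement E x q k * discountPrice E x ε k) ρ) x := by
  have hΔ := robustIncrement_mem (E := E) hq h01 x
  have hinc := increment_nonneg hq (fun y => (h01 y).1)
  rw [U₁_bundle_eq, menuValue_eq, add_sub_assoc]
  refine add_le_add le_rfl ?_
  have hεsum : ∑ k, robustIncrement E x q k * ε ≤ ε := by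
    rw [← Finset.sum_mul]
    refine mul_le_of_le_one_left hε.le ?_
    exact (Finset.sum_le_sum fun k _ => (hΔ k).2).trans (sum_increment_le_one h01)
  refine (sub_le_sub_left hεsum _).trans ?_
  rw [← Finset.sum_sub_distrib]
  refine Finset.sum_le_sum fun k _ => ?_
  -- An offered unit is surely bought by every y ≥ k, and a sale to a lower y costs the seller at
  -- most the discount. A withheld unit has price below her valuation at some y < k, hence by
  -- monotonicity of `v12` at all y ≥ k, so withholding it does no harm.
  by_cases hk : ∀ y < k, E.v₁ x y ≤ E.v₂ x k
  · have hD : robustIncrement E x q k = increment q k := if_pos hk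
    have h1 : increment q k * ε = ∑ y, E.p₂ y * (increment q k * ε) := by
      rw [← Finset.sum_mul, sum_p₂, one_mul]
    rw [hD, h1, ← Finset.sum_sub_distrib]
    refine Finset.sum_le_sum fun y _ => ?_
    rw [← mul_sub]
    refine mul_le_mul_of_nonneg_left ?_ (E.p₂_pos y).le
    have hw := inclusionProb_mem (hρ.1 y) k
    have hopt := inclusionProb_mul_eq hρ y k
    rw [hD] at hopt
    split_ifs with hky
    · have hc : 0 < b + E.v22 y - discountPrice E x ε k := by
        have := E.v22_strictMono.monotone hky
        simp only [discountPrice, Environment.v₂]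
        linarith
      rw [max_eq_left (mul_nonneg (hinc k) hc.le), ← mul_assoc] at hopt
      rw [mul_right_cancel₀ hc.ne' hopt]
      simp only [discountPrice]
      exact le_of_eq (by ring)
    · have h2 := hk y (not_le.1 hky)
      have h3 := mul_nonneg (mul_nonneg hw.1 (hinc k)) (sub_nonneg.2 h2)
      have h4 := mul_nonneg (mul_nonneg (sub_nonneg.2 hw.2) (hinc k)) hε.le
      simp only [discountPrice]
      nlinarith
  · have hD : robustIncrement E x q k = 0 := if_neg hk
    push Not at hk
    obtain ⟨y₁, hy₁, hlt⟩ := hk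
    simp only [hD, zero_mul, mul_zero, Finset.sum_const_zero, sub_zero]
    refine Finset.sum_nonpos fun y _ => mul_nonpos_of_nonneg_of_nonpos (E.p₂_pos y).le ?_
    split_ifs with hky
    · refine mul_nonpos_of_nonneg_of_nonpos (hinc k) ?_
      have := E.v12_mono (hy₁.le.trans hky)
      simp only [Environment.v₁] at hlt ⊢
      linarith
    · rfl

/-- A buyer who is less optimistic than a buyer who knows that the seller is of type `x` buys no
more than intended. -/
lemma tradeProb_le_of_pessimistic (hq : Monotone q) (h01 : ∀ y, q y ∈ Set.Icc (0 : ℝ) 1)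
    {x : Fin nx} {ε b : ℝ} (hε : ∀ y k, y < k → E.v22 y + ε < E.v22 k) (hb : b ≤ E.v21 x)
    {ρ : Fin ny → Finset (Fin ny) → ℝ}
    (hρ : IsMenuResponse E (bundleSum (robustIncrement E x q))
      (bundleSum fun k => robustIncrement E x q k * discountPrice E x ε k) b ρ) :
    (tradeProb E fun y => ∑ K, ρ y K * bundleSum (robustIncrement E x q) K) ≤ tradeProb E q := by
  have hΔ := robustIncrement_mem (E := E) hq h01 x
  refine Finset.sum_le_sum fun y _ => mul_le_mul_of_nonneg_left ?_ (E.p₂_pos y).le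
  beta_reduce
  rw [sum_mul_bundleSum, ← sum_increment q y]
  have hI : ∑ k ∈ Finset.Iic y, increment q k = ∑ k, if k ≤ y then increment q k else 0 := by
    rw [← Finset.sum_filter]
    congr 1
    ext; simp
  rw [hI]
  refine Finset.sum_le_sum fun k _ => ?_
  have hw := inclusionProb_mem (hρ.1 y) k
  split_ifs with hky
  · exact (mul_le_of_le_one_left (hΔ k).1 hw.2).trans (hΔ k).2
  -- The discount is smaller than any gap in `v22`, so unit k remains too expensive for types below
  -- k.
  · have hc : b + E.v22 y - discountPrice E x ε k < 0 := by
      have := hε y k (not_le.1 hky)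
      simp only [discountPrice, Environment.v₂]
      linarith
    have hopt := inclusionProb_mul_eq hρ y k
    rw [max_eq_right (mul_nonpos_of_nonneg_of_nonpos (hΔ k).1 hc.le), ← mul_assoc] at hopt
    exact ((mul_eq_zero.1 hopt).resolve_right hc.ne).le

end Robust

lemma exists_discount (E : Environment nx ny) {δ : ℝ} (hδ : 0 < δ) :
    ∃ ε, 0 < ε ∧ ε < δ ∧ ∀ y k, y < k → E.v22 y + ε < E.v22 k := by
  have h1 : ∀ᶠ ε in 𝓝[>] (0 : ℝ), 0 < ε := self_mem_nhdsWithin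
  have h2 : ∀ᶠ ε in 𝓝[>] (0 : ℝ), ε < δ := nhdsWithin_le_nhds (gt_mem_nhds hδ)
  have h3 : ∀ y k, ∀ᶠ ε in 𝓝[>] (0 : ℝ), y < k → E.v22 y + ε < E.v22 k := by
    intro y k
    by_cases h : y < k
    · have : ∀ᶠ ε in 𝓝[>] (0 : ℝ), ε < E.v22 k - E.v22 y :=
        nhdsWithin_le_nhds (gt_mem_nhds (sub_pos.2 (E.v22_strictMono h)))
      filter_upwards [this] with ε hε _
      linarith
    · simp [h]
  exact (h1.and (h2.and (eventually_all.2 fun y => eventually_all.2 (h3 y)))).exists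

end Bundles

/-! ### Equilibrium payoffs under D1. -/

namespace Assessment

variable {nx ny : ℕ} {E : Environment nx ny} [MeasurableSpace Mechanism]
  {A : Assessment nx ny}

lemma isSequentialEquilibrium (hA : A.IsEquilibrium E) (G : Mechanism) :
    (A.cont G).IsSequentialEquilibrium E (A.π₁ G) :=
  ⟨hA.2.1.2 G, hA.2.2.2 G⟩

lemma integrable_U₁ (hA : A.OutcomeIntegrable) (x : Fin nx) :
    Integrable (fun G => U₁ E (A.cont G).allocation x) (A.γ₁ x) := by
  have := A.γ₁_prob x
  unfold U₁ sellerReport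
  refine integrable_finsetSum _ fun y _ => Integrable.const_mul ?_ _
  exact (hA x y).2.add (((integrable_const 1).sub (hA x y).1).const_mul _)

lemma integral_U₁ (hA : A.OutcomeIntegrable) (x : Fin nx) :
    ∫ G, U₁ E (A.cont G).allocation x ∂(A.γ₁ x) = U₁ E A.allocation x := by
  have := A.γ₁_prob x
  unfold U₁ sellerReport
  have hq : ∀ y, Integrable (fun G => 1 - (A.cont G).allocation.q x y) (A.γ₁ x) := fun y =>
    (integrable_const 1).sub (hA x y).1
  have hsum : ∀ y, Integrable (fun G => E.p₂ y * ((A.cont G).allocation.t x y +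
      E.v₁ x y * (1 - (A.cont G).allocation.q x y))) (A.γ₁ x) := fun y =>
    ((hA x y).2.add ((hq y).const_mul (E.v₁ x y))).const_mul (E.p₂ y)
  rw [integral_finsetSum _ fun y _ => hsum y]
  refine Finset.sum_congr rfl fun y _ => ?_
  rw [integral_const_mul, integral_add (hA x y).2 ((hq y).const_mul _), integral_const_mul,
    integral_sub (integrable_const 1) (hA x y).1]
  simp [allocation]

/-- No offer makes any type of seller better off than in equilibrium. -/
lemma U₁_cont_le (hA : A.IsEquilibrium E) (G : Mechanism) (x : Fin nx) :
    U₁ E (A.cont G).allocation x ≤ U₁ E A.allocation x := by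
  rw [← integral_U₁ hA.1]
  exact hA.2.1.1 x G

/-- The equilibrium payoff is both an upper bound of the integrand and its mean. -/
lemma ae_U₁_cont_eq (hA : A.IsEquilibrium E) (x : Fin nx) :
    ∀ᵐ G ∂(A.γ₁ x), U₁ E (A.cont G).allocation x = U₁ E A.allocation x := by
  have := A.γ₁_prob x
  have hi := integrable_U₁ (E := E) hA.1 x
  have h0 : ∫ G, (U₁ E A.allocation x - U₁ E (A.cont G).allocation x) ∂(A.γ₁ x) = 0 := by
    rw [integral_sub (integrable_const _) hi, integral_U₁ hA.1]
    simp
  have h1 := (integral_eq_zero_iff_of_nonneg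
    (fun G => sub_nonneg.2 (U₁_cont_le hA G x)) ((integrable_const _).sub hi)).1 h0
  filter_upwards [h1] with G hG
  exact (sub_eq_zero.1 hG).symm

/-- Every type of seller makes some offer after which all the types that the buyer deems
possible receive their equilibrium payoffs. -/
lemma exists_offer (hA : A.IsEquilibrium E) (x : Fin nx) :
    ∃ G, 0 < A.π₁ G x ∧
      ∀ x', 0 < A.π₁ G x' → U₁ E (A.cont G).allocation x' = U₁ E A.allocation x' := by
  have hp : ∀ x', ENNReal.ofReal (E.p₁ x') ≠ 0 := fun x' => by simp [E.p₁_pos x']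
  -- Bayes' rule gives `γ₁ x'`, up to the positive factor `p₁ x'`, the density `π₁ · x'`.
  -- Almost-sure statements for different seller types can thus be combined under the common
  -- `offerLaw`.
  have hdens : ∀ x', ∀ P : Mechanism → Prop,
      (∀ᵐ G ∂(A.γ₁ x'), P G) ↔ ∀ᵐ G ∂(A.offerLaw E), 0 < A.π₁ G x' → P G := by
    intro x' P
    obtain ⟨hm, hd⟩ := hA.2.2.1 x'
    rw [← Measure.ae_ennreal_smul_measure_iff (hp x'), hd,
      ae_withDensity_iff' hm.ennreal_ofReal]
    simp
  have h1 : ∀ᵐ G ∂(A.offerLaw E), ∀ x', 0 < A.π₁ G x' →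
      U₁ E (A.cont G).allocation x' = U₁ E A.allocation x' :=
    ae_all_iff.2 fun x' => (hdens x' _).1 (ae_U₁_cont_eq hA x')
  have h2 : ∀ᵐ G ∂(A.γ₁ x), 0 < A.π₁ G x ∧ ∀ x', 0 < A.π₁ G x' →
      U₁ E (A.cont G).allocation x' = U₁ E A.allocation x' := by
    rw [hdens]
    filter_upwards [h1] with G hG hx using ⟨hx, hG⟩
  have := A.γ₁_prob x
  exact h2.exists

/-- Under D1, a type of seller obtains the menu value of any allocation rule by which she would
distinguish herself from all lower types. -/
lemma menuValue_le (hA : A.IsEquilibrium E) (hD1 : A.PassesD1 E) {x₀ : Fin nx}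
    {q : Fin ny → ℝ} (hq : Monotone q) (h01 : ∀ y, q y ∈ Set.Icc (0 : ℝ) 1)
    (hsep : ∀ x < x₀, U₁ E A.allocation x₀ - U₁ E A.allocation x <
      (E.v11 x₀ - E.v11 x) * (1 - tradeProb E q)) :
    menuValue E x₀ q ≤ U₁ E A.allocation x₀ := by
  by_contra hlt
  rw [not_le] at hlt
  obtain ⟨ε, hε, hεgap, hεstep⟩ := exists_discount E (sub_pos.2 hlt)
  let Q := bundleSum (robustIncrement E x₀ q)
  let T := bundleSum fun k => robustIncrement E x₀ q k * discountPrice E x₀ ε k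
  let G := menu Q T (bundleSum_robust_mem hq h01 x₀)
  have hQ : Q ∅ = 0 := by simp [Q, bundleSum]
  have hT : T ∅ = 0 := by simp [T, bundleSum]
  have hopt : ∀ {b ρ}, IsMenuResponse E Q T b ρ → E.v21 x₀ ≤ b →
      menuValue E x₀ q - ε ≤ U₁ E (menuOutcome Q T ρ) x₀ := fun hρ hb =>
    menuValue_le_of_optimistic hq h01 hε hb hρ
  have hpess : ∀ {b ρ}, IsMenuResponse E Q T b ρ → b ≤ E.v21 x₀ → ∀ x < x₀,
      U₁ E (menuOutcome Q T ρ) x + (E.v11 x₀ - E.v11 x) * (1 - tradeProb E q) ≤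
        U₁ E (menuOutcome Q T ρ) x₀ := by
    intro b ρ hρ hb x hx
    rw [U₁_menuOutcome_sub Q T ρ x₀ x]
    have h := tradeProb_le_of_pessimistic hq h01 hεstep hb hρ
    have hv := E.v11_strictMono hx
    gcongr
  obtain ⟨ρ₀, hρ₀, hg₀⟩ := exists_menuResponse_of_mem_BR (A.π₁_mem G) hQ hT
    ⟨A.cont G, isSequentialEquilibrium hA G, rfl⟩
  have hU₀ : U₁ E (menuOutcome Q T ρ₀) x₀ ≤ U₁ E A.allocation x₀ := by
    rw [← hg₀]
    exact U₁_cont_le hA G x₀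
  have hzero : ∀ x < x₀, A.π₁ G x = 0 := by
    intro x hx
    refine hD1 G x ⟨x₀, hx.ne', ?_, fun hsub => ?_⟩
    · have key : ∀ g ∈ BRAll E G, U₁ E A.allocation x ≤ U₁ E g x →
          g ∈ D E A.allocation x₀ G := by
        rintro g hg hle
        refine ⟨hg, ?_⟩
        obtain ⟨π, hπ, hBR⟩ := hg
        obtain ⟨ρ, hρ, rfl⟩ := exists_menuResponse_of_mem_BR hπ hQ hT hBR
        rcases le_total (E.v21 x₀) (meanValue E π) with hb | hb
        · linarith [hopt hρ hb]
        · linarith [hpess hρ hb x hx, hsep x hx]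
      rintro g (⟨hg, h⟩ | ⟨hg, h⟩)
      · exact key g hg h.le
      · exact key g hg h.ge
    -- For strict inclusion, find a response that pays x₀ just δ above equilibrium. An optimistic
    -- buyer would pay her more than that, so he is pessimistic; then the separation slack, which
    -- exceeds δ, puts x strictly below her equilibrium payoff.
    · obtain ⟨δ, hδ, hδ'⟩ := exists_between (lt_min
        (sub_pos.2 hεgap) (sub_pos.2 (hsep x hx)))
      obtain ⟨hδ1, hδ2⟩ := lt_min_iff.1 hδ'
      obtain ⟨ρ₁, hρ₁⟩ := exists_menuResponse (E := E) Q T (meanValue E (Pi.single x₀ 1))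
      have hU₁ := hopt hρ₁ (meanValue_single x₀).ge
      -- Interpolate between the actual continuation, which pays x₀ at most her equilibrium payoff,
      -- and the response of a buyer who is sure of x₀.
      obtain ⟨π, hπ, ρ, hρ, hval⟩ := exists_menuResponse_payoff_eq (A.π₁_mem G)
        (single_mem_stdSimplex ℝ x₀) hρ₀ hρ₁ (x := x₀) (u := U₁ E A.allocation x₀ + δ)
        (by linarith) (by linarith)
      have hmem : menuOutcome Q T ρ ∈ D E A.allocation x₀ G :=
        ⟨⟨π, hπ, menuOutcome_mem_BR hπ hQ hT hρ⟩, by rw [hval]; linarith⟩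
      have hge : U₁ E A.allocation x ≤ U₁ E (menuOutcome Q T ρ) x := by
        rcases hsub hmem with h | h
        · exact h.2.le
        · exact h.2.ge
      rcases le_total (E.v21 x₀) (meanValue E π) with hb | hb
      · linarith [hopt hρ hb]
      · linarith [hpess hρ hb x hx]
  linarith [hopt hρ₀ (le_meanValue (A.π₁_mem G) hzero)]

/-- Under D1, the equilibrium payoffs are bounded below by those of any allocation that satisfies
the constraints that define RSW allocations. -/
lemma U₁_le_of_RSWConstraints (hA : A.IsEquilibrium E) (hD1 : A.PassesD1 E)
    {g : Allocation nx ny} (hg : RSWConstraints E g) (x : Fin nx) :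
    U₁ E g x ≤ U₁ E A.allocation x := by
  induction x using WellFoundedLT.induction with
  | ind x₀ ih =>
    by_contra hlt
    rw [not_le] at hlt
    obtain ⟨hvalid, hseller, hIC, hIR⟩ := hg
    refine hlt.not_ge ((U₁_le_menuValue hIC hIR x₀).trans (menuValue_le hA hD1
      (monotone_of_incentive_compatible (v₂_strictMono x₀) (hIC x₀)) (hvalid x₀) ?_))
    -- The payoff of x in `g` is at most her equilibrium payoff by induction, while that of x₀ is
    -- above hers; the constraint that x not mimic x₀ in `g` therefore gives strict separation.
    intro x hx
    have h1 := hseller x x₀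
    rw [sellerReport_eq] at h1
    linarith [ih x hx]

lemma noTrade_le (hA : A.IsEquilibrium E) (x : Fin nx) :
    ∑ y, E.p₂ y * E.v₁ x y ≤ U₁ E A.allocation x := by
  have h := U₁_cont_le hA (menu (S := Unit) (fun _ => 0) (fun _ => 0) (by simp)) x
  rw [menu_allocation] at h
  simpa [U₁, sellerReport] using h

/-- Under D1, the equilibrium payoff of every type of seller is the value of a menu that reveals
her type and that no other type of seller prefers to her equilibrium payoff. -/
lemma exists_menu_eq (hA : A.IsEquilibrium E) (hD1 : A.PassesD1 E) (x₀ : Fin nx) :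
    ∃ r : Fin ny → ℝ, Monotone r ∧ (∀ y, r y ∈ Set.Icc (0 : ℝ) 1) ∧
      menuValue E x₀ r = U₁ E A.allocation x₀ ∧
      ∀ x, U₁ E A.allocation x₀ + (E.v11 x - E.v11 x₀) * (1 - tradeProb E r) ≤
        U₁ E A.allocation x := by
  obtain ⟨G, hG, hU⟩ := exists_offer hA x₀
  have hfeas := (isSequentialEquilibrium hA G).interimFeasible
  have hπ := A.π₁_mem G
  obtain ⟨r, h01, htp, hmono, hsum⟩ := hfeas.exists_menus hπ
  have hsep : ∀ x, 0 < A.π₁ G x → ∀ x',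
      U₁ E A.allocation x + (E.v11 x' - E.v11 x) * (1 - tradeProb E (r x)) ≤
        U₁ E A.allocation x' := by
    intro x hx x'
    rw [← hU x hx, htp, ← sellerReport_eq]
    exact (hfeas.seller x' x).trans (U₁_cont_le hA G x')
  have hle : ∀ x, 0 < A.π₁ G x → menuValue E x (r x) ≤ U₁ E A.allocation x := by
    intro x hx
    rcases (tradeProb_mem (E := E) (h01 x)).1.eq_or_lt with h0 | h0
    · have hr : r x = fun _ => 0 := by
        funext y
        have := (Finset.sum_eq_zero_iff_of_nonneg fun y _ =>
          mul_nonneg (E.p₂_pos y).le (h01 x y).1).1 h0.symm y (Finset.mem_univ y)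
        exact (mul_eq_zero.1 this).resolve_left (E.p₂_pos y).ne'
      have h := menuValue_smul (E := E) x 0 (r x)
      simp only [zero_mul, sub_zero, one_mul, zero_add] at h
      rw [hr, h]
      exact noTrade_le hA x
    -- Equilibrium gives only weak separation. Scaling the rule by a < 1 lowers the probability of
    -- trade and makes it strict; then let a tend to 1.
    · have hscaled : ∀ a ∈ Set.Ioo (0 : ℝ) 1,
          a * menuValue E x (r x) + (1 - a) * ∑ y, E.p₂ y * E.v₁ x y ≤ U₁ E A.allocation x := by
        intro a ha
        rw [← menuValue_smul]
        refine menuValue_le hA hD1 ((hmono x hx).const_mul ha.1.le) (fun y =>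
          ⟨mul_nonneg ha.1.le (h01 x y).1, mul_le_one₀ ha.2.le (h01 x y).1 (h01 x y).2⟩) ?_
        intro x' hx'
        have h1 := hsep x hx x'
        have h2 : tradeProb E (fun y => a * r x y) = a * tradeProb E (r x) := by
          simp only [tradeProb, Finset.mul_sum]
          exact Finset.sum_congr rfl fun y _ => by ring
        have h3 := mul_pos (sub_pos.2 (E.v11_strictMono hx'))
          (mul_pos (sub_pos.2 ha.2) h0)
        rw [h2]
        nlinarith
      have hc : Continuous fun a : ℝ =>
          a * menuValue E x (r x) + (1 - a) * ∑ y, E.p₂ y * E.v₁ x y := by fun_prop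
      have hlim := (hc.tendsto 1).mono_left (nhdsWithin_le_nhds (s := Set.Iio 1))
      simp only [one_mul, sub_self, zero_mul, add_zero] at hlim
      refine le_of_tendsto hlim ?_
      filter_upwards [Ioo_mem_nhdsLT (zero_lt_one' ℝ)] with a ha using hscaled a ha
  refine ⟨r x₀, hmono x₀ hG, h01 x₀, le_antisymm (hle x₀ hG) ?_, hsep x₀ hG⟩
  by_contra hlt
  rw [not_le] at hlt
  -- No menu in the support beats the equilibrium payoff, so a shortfall at x₀, whose weight is
  -- positive, would contradict the comparison of averages.
  refine hsum.not_gt (Finset.sum_lt_sum (fun x _ => ?_) ⟨x₀, Finset.mem_univ _, ?_⟩)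
  · rcases (hπ.1 x).eq_or_lt with h | h
    · simp [← h]
    · rw [hU x h]
      exact mul_le_mul_of_nonneg_left (hle x h) h.le
  · rw [hU x₀ hG]
    exact mul_lt_mul_of_pos_left hlt hG

/-- Under D1, the equilibrium payoffs are those of some allocation that satisfies the constraints
that define RSW allocations. -/
lemma exists_RSWConstraints_eq (hA : A.IsEquilibrium E) (hD1 : A.PassesD1 E) :
    ∃ g, RSWConstraints E g ∧ U₁ E g = U₁ E A.allocation := by
  choose r hmono h01 hval hsep using exists_menu_eq hA hD1
  let g : Allocation nx ny := ⟨r, fun x => payment (E.v₂ x) (r x)⟩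
  have hU : U₁ E g = U₁ E A.allocation := funext hval
  refine ⟨g, ⟨h01, fun x x' => ?_, fun x y y' => ?_, fun x y => ?_⟩, hU⟩
  · rw [sellerReport_eq, hU]
    exact hsep x' x
  · exact payment_incentive_compatible (v₂_strictMono x).monotone (hmono x)
      (fun y => (h01 x y).1) y y'
  · exact payment_individually_rational (v₂_strictMono x).monotone (hmono x)
      (fun y => (h01 x y).1) y

end Assessment

end InformedSeller

theorem theorem2 {nx ny : ℕ} (E : InformedSeller.Environment nx ny)
    [MeasurableSpace InformedSeller.Mechanism]
    (A : InformedSeller.Assessment nx ny)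
    (hEq : A.IsEquilibrium E) (hD1 : A.PassesD1 E) :
    (∃ g : InformedSeller.Allocation nx ny, InformedSeller.IsRSW E g) ∧
      ∀ g : InformedSeller.Allocation nx ny, InformedSeller.IsRSW E g →
        InformedSeller.U₁ E A.allocation = InformedSeller.U₁ E g := by
  obtain ⟨g', hg', hU⟩ := InformedSeller.Assessment.exists_RSWConstraints_eq hEq hD1
  have hle : ∀ {g}, InformedSeller.RSWConstraints E g → ∀ x,
      InformedSeller.U₁ E g x ≤ InformedSeller.U₁ E A.allocation x := fun hg =>
    InformedSeller.Assessment.U₁_le_of_RSWConstraints hEq hD1 hg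
  refine ⟨⟨g', hg', fun x g hg => (hle hg x).trans (congrFun hU x).ge⟩, fun g hg => ?_⟩
  funext x
  exact le_antisymm ((congrFun hU x).ge.trans (hg.2 x g' hg')) (hle hg.1 x)
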